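/- Let $F_q$ be the finite field with $q$ elements and let $R_2=F_q[x_1,x_2,y_1,y_2]$. A pair $(A,B)\in SL_2(F_q)\times SL_2(F_q)$ acts on $R_2$ by the $F_q$-algebra automorphism that replaces the column $(x_1,x_2)^t$ by $(A^t)^{-1}(x_1,x_2)^t$ and the column $(y_1,y_2)^t$ by $B(y_1,y_2)^t$. Let $R_2^{SL_2\times SL_2}$ be the ring of invariants of this action, and let $R_2^{SL_2}$ be the ring of polynomials invariant under all $(A,A)$, $A\in SL_2(F_q)$. Let $*$ be the algebra involution of $R_2$ with $x_1\leftrightarrow y_2$, $x_2\leftrightarrow y_1$. Put $$d_{2,2}=x_2x_1^q-x_1x_2^q,\qquad c_{2,1}=\frac{x_2x_1^{q^2}-x_1x_2^{q^2}}{d_{2,2}},\qquad u_0=x_1y_1+x_2y_2,\qquad u_1=x_1^qy_1+x_2^qy_2,$$ $$h_s=\frac{u_1^{s+1}(d_{2,2}^*)^{q-s-1}+(u_1^*)^{q-s}d_{2,2}^s}{u_0^q}\qquad(0\le s\le q-1).$$ Theorem 3.3. The quotients $c_{2,1}$ and $h_s$ $(0\le s\le q-1)$ are polynomials. The four polynomials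 $d_{2,2},c_{2,1},d_{2,2}^*,c_{2,1}^*$ are algebraically independent over $F_q$, and $R_2^{SL_2\times SL_2}=F_q[d_{2,2},c_{2,1},d_{2,2}^*,c_{2,1}^*]$. The ring $R_2^{SL_2}$ is a free module over $R_2^{SL_2\times SL_2}$, with a basis consisting of the $q(q^2-1)$ elements $$\begin{aligned} &(u_1^*)^iu_1^j, && 0\le i,j\le q-1;\\ &(u_1^*)^iu_1^ju_0^k, && 0\le i,j\le q-2,\ 1\le k\le q;\\ &h_su_0^k, && 1\le s\le q-2,\ 0\le k\le q-1. \end{aligned}$$ Consequently, for the grading by total degree, the Hilbert series $H(R_2^{SL_2},t)=\sum_{n\ge0}\dim_{F_q}(R_2^{SL_2})_n\,t^n$ is $$H(R_2^{SL_2},t)=\frac{H_1(t)+\sum_{k=1}^{q}H_2(k,t)+H_3(t)}{(1-t^{q+1})^2(1-t^{q^2-q})^2},$$ where $$\begin{aligned} H_1(t)&=\sum_{m=0}^{q-1}(m+1)t^{m(q+1)}+\sum_{m=0}^{q-2}(q-1-m)t^{(q+m)(q+1)},\\ H_2(k,t)&=\sum_{m=0}^{q-2}(m+1)t^{2k+m(q+1)}+\sum_{m=0}^{q-3}(q-2-m)t^{2k+(q-1+m)(q+1)},\\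 H_3(t)&=\sum_{k=0}^{q-1}(q-2)t^{q^2-q+2k} \end{aligned}$$ (empty sums are $0$). -/

import Mathlib

open MvPolynomial

namespace VectorCovector

noncomputable section

/-- The polynomial ring `F[x₁, x₂, y₁, y₂]`: the variables `x₁, x₂` are indexed by the left
summand, the variables `y₁, y₂` by the right summand. -/
abbrev R (F : Type*) [Field F] : Type _ := MvPolynomial (Fin 2 ⊕ Fin 2) F

section Action

variable {F : Type*} [Field F]

/-- The variables `x₁ = x 0`, `x₂ = x 1`. -/
def x (i : Fin 2) : R F := X (Sum.inl i)

/-- The variables `y₁ = y 0`, `y₂ = y 1`. -/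
def y (i : Fin 2) : R F := X (Sum.inr i)

/-- The substitution by which the pair `(A, B)` acts on `F[x₁, x₂, y₁, y₂]`: the column of the
`x`'s is replaced by `(Aᵗ)⁻¹` times this column, and the column of the `y`'s by `B` times this
column. -/
def act (A B : Matrix.SpecialLinearGroup (Fin 2) F) : R F →ₐ[F] R F :=
  aeval (Sum.elim
    (fun i => ∑ j, C (((A⁻¹ : Matrix.SpecialLinearGroup (Fin 2) F) : Matrix (Fin 2) (Fin 2) F) j i) * x j)
    (fun i => ∑ j, C ((B : Matrix (Fin 2) (Fin 2) F) i j) * y j))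

/-- The ring of invariants of `SL₂(F)`, embedded diagonally by `A ↦ (A, A)`. -/
def invSL (F : Type*) [Field F] : Subalgebra F (R F) where
  carrier := {f | ∀ A, act A A f = f}
  mul_mem' hf hg A := by rw [map_mul, hf A, hg A]
  add_mem' hf hg A := by rw [map_add, hf A, hg A]
  algebraMap_mem' r A := AlgHom.commutes _ r

/-- The ring of invariants of `SL₂(F) × SL₂(F)`. -/
def invSLSL (F : Type*) [Field F] : Subalgebra F (R F) where
  carrier := {f | ∀ A B, act A B f = f}
  mul_mem' hf hg A B := by rw [map_mul, hf A B, hg A B]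
  add_mem' hf hg A B := by rw [map_add, hf A B, hg A B]
  algebraMap_mem' r A B := AlgHom.commutes _ r

theorem invSLSL_le_invSL (F : Type*) [Field F] : invSLSL F ≤ invSL F :=
  fun _ hf A => hf A A

/-- `R^{SL₂}` as an algebra (in particular, a module) over its subring `R^{SL₂ × SL₂}`. -/
instance algebraInv (F : Type*) [Field F] : Algebra (invSLSL F) (invSL F) :=
  (Subalgebra.inclusion (invSLSL_le_invSL F)).toRingHom.toAlgebra

instance moduleInv (F : Type*) [Field F] : Module (invSLSL F) (invSL F) :=
  (algebraInv F).toModule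

instance smulInv (F : Type*) [Field F] : SMul (invSLSL F) (invSL F) :=
  (algebraInv F).toSMul

theorem coe_smul_inv (a : invSLSL F) (f : invSL F) :
    ((a • f : invSL F) : R F) = (a : R F) * (f : R F) := rfl

/-- The involution `x₁ ↦ y₂, x₂ ↦ y₁, y₁ ↦ x₂, y₂ ↦ x₁`. -/
def invol : R F →ₐ[F] R F :=
  aeval (Sum.elim (fun i => y i.rev) (fun i => x i.rev))

open Classical in
/-- The quotient `a / b` of two polynomials if `b` divides `a` (it is unique when `b ≠ 0`), and
`0` otherwise. -/
def exactQuot (a b : R F) : R F := if h : b ∣ a then h.choose else 0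

end Action

section Invariants

variable (F : Type*) [Field F] [Fintype F]

local notation "q" => Fintype.card F

/-- The Dickson invariant `d_{2,2}`. -/
def d : R F := Matrix.det !![x 1, x 1 ^ q; x 0, x 0 ^ q]

/-- The numerator of the Dickson invariant `c_{2,1}`. -/
def cNum : R F := Matrix.det !![x 1, x 1 ^ (q ^ 2); x 0, x 0 ^ (q ^ 2)]

/-- The Dickson invariant `c_{2,1}`. -/
def c : R F := exactQuot (cNum F) (d F)

/-- `d_{2,2}^*`. -/
def dStar : R F := invol (d F)

/-- `c_{2,1}^*`. -/
def cStar : R F := invol (c F)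

def u₀ : R F := x 0 * y 0 + x 1 * y 1

def u₁ : R F := x 0 ^ q * y 0 + x 1 ^ q * y 1

/-- `u_1^*`. -/
def u₁Star : R F := invol (u₁ F)

/-- The numerator of `h_s`. -/
def hNum (s : ℕ) : R F :=
  u₁ F ^ (s + 1) * dStar F ^ (q - s - 1) + u₁Star F ^ (q - s) * d F ^ s

/-- `h_s`, for `0 ≤ s ≤ q - 1`. -/
def h (s : ℕ) : R F := exactQuot (hNum F s) (u₀ F ^ q)

/-- The index set of the basis: the pairs `(i, j)` with `0 ≤ i, j ≤ q - 1`, the triples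
`(i, j, k - 1)` with `0 ≤ i, j ≤ q - 2` and `1 ≤ k ≤ q`, and the pairs `(s - 1, k)` with
`1 ≤ s ≤ q - 2` and `0 ≤ k ≤ q - 1`. -/
abbrev BasisIndex : Type :=
  (Fin q × Fin q) ⊕ (Fin (q - 1) × Fin (q - 1) × Fin q) ⊕ (Fin (q - 2) × Fin q)

/-- The elements of the basis. -/
def basisElt : BasisIndex F → R F
  | .inl (i, j) => u₁Star F ^ (i : ℕ) * u₁ F ^ (j : ℕ)
  | .inr (.inl (i, j, k)) => u₁Star F ^ (i : ℕ) * u₁ F ^ (j : ℕ) * u₀ F ^ ((k : ℕ) + 1)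
  | .inr (.inr (s, k)) => h F ((s : ℕ) + 1) * u₀ F ^ (k : ℕ)

end Invariants

section Hilbert

/-- The Hilbert series `∑ dim A_n t^n` of a graded subalgebra `A` of `F[x₁, x₂, y₁, y₂]`, where
`A_n` is the space of those elements of `A` that are homogeneous of degree `n`. -/
def hilbertSeries {F : Type*} [Field F] (A : Subalgebra F (R F)) : PowerSeries ℤ :=
  PowerSeries.mk fun n =>
    (Module.finrank F ↥(Subalgebra.toSubmodule A ⊓ homogeneousSubmodule (Fin 2 ⊕ Fin 2) F n) : ℤ)

local notation "t" => (PowerSeries.X : PowerSeries ℤ)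

/-- `1 + 2 t^(q+1) + ⋯ + q t^(q²-1) + (q-1) t^(q²+q) + ⋯ + t^(2q²-2)`. -/
def H₁ (q : ℕ) : PowerSeries ℤ :=
  ∑ m ∈ Finset.range q, ((m + 1 : ℕ) : PowerSeries ℤ) * t ^ (m * (q + 1)) +
  ∑ m ∈ Finset.range (q - 1), ((q - 1 - m : ℕ) : PowerSeries ℤ) * t ^ ((q + m) * (q + 1))

/-- `t^(2k) + 2 t^(2k+q+1) + ⋯ + (q-1) t^(2k+q²-q-2) + (q-2) t^(2k+q²-1) + ⋯ + t^(2k+2q²-2q-4)`. -/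
def H₂ (q k : ℕ) : PowerSeries ℤ :=
  ∑ m ∈ Finset.range (q - 1), ((m + 1 : ℕ) : PowerSeries ℤ) * t ^ (2 * k + m * (q + 1)) +
  ∑ m ∈ Finset.range (q - 2),
    ((q - 2 - m : ℕ) : PowerSeries ℤ) * t ^ (2 * k + (q - 1 + m) * (q + 1))

/-- `(q-2) t^(q²-q) + (q-2) t^(q²-q+2) + ⋯ + (q-2) t^(q²+q-2)`. -/
def H₃ (q : ℕ) : PowerSeries ℤ :=
  ∑ k ∈ Finset.range q, ((q - 2 : ℕ) : PowerSeries ℤ) * t ^ (q ^ 2 - q + 2 * k)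

end Hilbert

end

end VectorCovector

/-!
Write `A = F[d, c, d*, c*]`, `B` for the invariants of `SL₂`, `N = q (q² - 1)` for the order of
`SL₂(F)`, and `M` for the `A`-module spanned by the elements `basisElt`.

*Descent.* Galois theory enters through two lemmas on a finite group `G` acting on a domain. If
`|G|` elements `e i` span enough of the domain over a ring `C` of invariants, then Dedekind's
independence of characters makes the matrix `(g (e i))` nonsingular, so that the `e i` are linearly
independent over all invariants (`eq_zero_of_sum_mul_eq_zero`); if in addition `1` is one of the
`e i`, an invariant in their `C`-span belongs to `C` (`mem_of_mem_span_of_invariant`).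

*Dickson invariants.* Let `n = x₁ ^ q - x₁ x₂ ^ (q - 1)`. From `d = x₂ n` and
`c = n ^ (q - 1) + x₂ ^ (q² - q)` one reads off `N` generators of `F[x₁, x₂]` over `F[d, c]`, one
of them being `1`. Together with their images under the involution they give `N²` generators of the
polynomial ring over `A`; hence `A` is the ring of invariants of `SL₂ × SL₂` (`invSLSL_eq`), and its
four generators are algebraically independent because the polynomial ring, of transcendence degree
four, is integral over `A` (`algebraicIndependent_dickson`).

*Spanning.* The relations `u₁ u₁* = u₀ ^ (q + 1) + d d*`,
`u₁ h_s = d* h_(s+1) + u₀ (u₁*) ^ (q - s - 1) d ^ s`, `h_0 = c*`, `h_(q-1) = c` and the definition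
of `h_s` show that `M` is stable under multiplication by `u₀` and `u₁` (`u₀_mul_mem`, `u₁_mul_mem`),
so it contains `F[d, c, u₀, u₁]`. Since `d y₁` and `d y₂` are combinations of `u₀, u₁` with
coefficients in `F[x₁, x₂]`, descent gives `B[1/d] = F[d, c, u₀, u₁][1/d]`
(`exists_d_pow_mul_mem_adjoin`). Thus every `f ∈ B` has a multiple `d ^ m f` in `M` and, `M` being
stable under the involution, also a multiple `(d*) ^ n f` in `M`. The `N` elements `basisElt` are
linearly independent over `A` by descent (`sum_mul_basisElt_eq_zero`), and `d`, `d*` are distinct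
variables of the polynomial ring `A`, so `f` itself is in `M` (`mem_basisModule`).

*Hilbert series.* The monomials in `d, c, d*, c*` times the basis elements form a homogeneous basis
of `B` over `F`; its generating function is the sum of `t ^ deg` over `basisElt`, divided by the
four factors `1 - t ^ w` (`genFun_prod`). The double geometric sums are collected by
`geom_sum_sq`.
-/

namespace VectorCovector

/-! ### Descent along a finite family of endomorphisms -/

section Descent

variable {K S G ι : Type*} [Field K] [CommRing S] [Algebra K S] [Fintype G] [Fintype ι]

theorem mul_mem_of_mem_adjoin {C : Subalgebra K S} (E : Submodule C S) (s : Set S)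
    (hs : ∀ a ∈ s, ∀ m ∈ E, a * m ∈ E) {f : S} (hf : f ∈ Algebra.adjoin K s) :
    ∀ m ∈ E, f * m ∈ E := by
  induction hf using Algebra.adjoin_induction with
  | mem a ha => exact hs a ha
  | algebraMap r =>
    intro m hm
    have := E.smul_mem (algebraMap K C r) hm
    rwa [Algebra.smul_def] at this
  | add a b _ _ h1 h2 => intro m hm; rw [add_mul]; exact E.add_mem (h1 m hm) (h2 m hm)
  | mul a b _ _ h1 h2 => intro m hm; rw [mul_assoc]; exact h1 _ (h2 m hm)

theorem mul_mem_of_mem {C : Subalgebra K S} (E : Submodule C S) {a m : S} (ha : a ∈ C)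
    (hm : m ∈ E) : a * m ∈ E := by
  have := E.smul_mem (⟨a, ha⟩ : C) hm
  rwa [Algebra.smul_def] at this

theorem mul_mem_of_mem_span {C : Subalgebra K S} (E : Submodule C S) (s : Set S) (a : S)
    (hs : ∀ m ∈ s, a * m ∈ E) {m : S} (hm : m ∈ Submodule.span C s) : a * m ∈ E := by
  induction hm using Submodule.span_induction with
  | mem m hm => exact hs m hm
  | zero => simp
  | add m m' _ _ h1 h2 => rw [mul_add]; exact E.add_mem h1 h2
  | smul r m _ h1 => rw [mul_smul_comm]; exact E.smul_mem r h1

variable [IsDomain S]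

/-- If `|G|` elements `e i` span, over `G`-invariants, a multiplicative set on which the
endomorphisms `σ g` are pairwise distinct, then they are linearly independent over all invariants.
By Dedekind's independence of characters the square matrix `(σ g (e i))` is nonsingular, and it
annihilates the coefficient vector of every invariant linear relation. -/
theorem eq_zero_of_sum_mul_eq_zero (hcard : Fintype.card ι = Fintype.card G)
    (σ : G → S →ₐ[K] S) (T : Submonoid S)
    (hσ : ∀ g g', (∀ m ∈ T, σ g m = σ g' m) → g = g') (e : ι → S) (C : Subalgebra K S)
    (hC : ∀ a ∈ C, ∀ g, σ g a = a) (hspan : ∀ m ∈ T, m ∈ Submodule.span C (Set.range e))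
    (a : ι → S) (ha : ∀ i g, σ g (a i) = a i) (hsum : ∑ i, a i * e i = 0) (i : ι) : a i = 0 := by
  classical
  let ε : ι ≃ G := Fintype.equivOfCardEq hcard
  let P : Matrix G G S := fun g k => σ g (e (ε.symm k))
  have hdet : P.det ≠ 0 := by
    intro h0
    obtain ⟨v, hv, hvP⟩ := Matrix.exists_vecMul_eq_zero_iff.2 h0
    apply hv
    -- a left null vector is a linear relation between the distinct characters `σ g` of `T`
    have hrel : ∀ m ∈ Submodule.span C (Set.range e), ∑ g, v g * σ g m = 0 := by
      intro m hm
      induction hm using Submodule.span_induction with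
      | mem m hm =>
        obtain ⟨j, rfl⟩ := hm
        have := congrFun hvP (ε j)
        simpa [P, Matrix.vecMul, dotProduct] using this
      | zero => simp
      | add m m' _ _ h1 h2 => simp [mul_add, Finset.sum_add_distrib, h1, h2]
      | smul r m _ h1 =>
        have : ∀ g, v g * σ g (r • m) = r * (v g * σ g m) := by
          intro g
          rw [Subalgebra.smul_def, smul_eq_mul, map_mul, hC _ r.2]
          ring
        simp [this, ← Finset.mul_sum, h1]
    have hli := linearIndependent_monoidHom T S
    let χ : G → (T →* S) := fun g => ((σ g : S →* S)).comp T.subtype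
    have hχ : Function.Injective χ := fun g g' hgg => hσ g g' fun m hm =>
      DFunLike.congr_fun hgg (⟨m, hm⟩ : T)
    have hli' := hli.comp χ hχ
    rw [Fintype.linearIndependent_iff] at hli'
    funext g
    refine hli' v ?_ g
    funext m
    simpa [χ] using hrel m (hspan m m.2)
  by_contra hne
  refine hdet (Matrix.exists_mulVec_eq_zero_iff.1 ⟨fun k => a (ε.symm k), ?_, ?_⟩)
  · intro h0
    exact hne (by simpa using congrFun h0 (ε i))
  · funext g
    have := congrArg (σ g) hsum
    simp only [map_sum, map_mul, ha, map_zero] at this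
    simp only [Matrix.mulVec, dotProduct, P, Pi.zero_apply]
    rw [← this]
    exact Fintype.sum_equiv ε.symm _ _ fun k => by ring

/-- If moreover some `e i₀` is `1`, an invariant in the span of the `e i` lies in the ring of
coefficients: `f * e i₀` and the expansion of `f` have the same coefficients. This replaces the
usual arguments by degrees of field extensions and integral closedness. -/
theorem mem_of_mem_span_of_invariant (hcard : Fintype.card ι = Fintype.card G)
    (σ : G → S →ₐ[K] S) (T : Submonoid S)
    (hσ : ∀ g g', (∀ m ∈ T, σ g m = σ g' m) → g = g') (e : ι → S) (C : Subalgebra K S)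
    (hC : ∀ a ∈ C, ∀ g, σ g a = a) (hspan : ∀ m ∈ T, m ∈ Submodule.span C (Set.range e))
    (i₀ : ι) (hi₀ : e i₀ = 1) (f : S) (hf : ∀ g, σ g f = f)
    (hfe : f ∈ Submodule.span C (Set.range e)) : f ∈ C := by
  classical
  obtain ⟨r, hr⟩ := (Submodule.mem_span_range_iff_exists_fun _).1 hfe
  have key := eq_zero_of_sum_mul_eq_zero hcard σ T hσ e C hC hspan
    (fun i => (r i : S) - if i = i₀ then f else 0) ?_ ?_ i₀
  · have : f = r i₀ := by simpa [sub_eq_zero, eq_comm] using key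
    rw [this]
    exact (r i₀).2
  · intro i g
    simp only [map_sub, hC _ (r i).2]
    split_ifs <;> simp [hf]
  · simp only [sub_mul, Finset.sum_sub_distrib, ite_mul, zero_mul, Finset.sum_ite_eq',
      Finset.mem_univ, if_true, hi₀, mul_one]
    rw [sub_eq_zero, ← hr]
    simp [Algebra.smul_def]

end Descent

/-! ### The order of `SL₂` over a finite field -/

theorem natCard_specialLinearGroup (F : Type*) [Field F] [Fintype F] :
    Nat.card (Matrix.SpecialLinearGroup (Fin 2) F) =
      Fintype.card F * (Fintype.card F ^ 2 - 1) := by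
  have hker : (Matrix.GeneralLinearGroup.det (n := Fin 2) (R := F)).ker =
      (Matrix.SpecialLinearGroup.toGL (n := Fin 2) (R := F)).range := by
    ext g
    rw [MonoidHom.mem_ker, MonoidHom.mem_range]
    constructor
    · intro hg
      refine ⟨⟨g.1, by simpa using congrArg Units.val hg⟩, ?_⟩
      ext i j
      rfl
    · rintro ⟨A, rfl⟩
      ext
      simp
  have hcard : Nat.card (Matrix.GeneralLinearGroup.det (n := Fin 2) (R := F)).ker =
      Nat.card (Matrix.SpecialLinearGroup (Fin 2) F) := by
    rw [hker]
    refine (Nat.card_congr (MonoidHom.ofInjective ?_).toEquiv).symm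
    intro A B hAB
    ext i j
    exact congrFun (congrFun
      (congrArg (fun g : GL (Fin 2) F => (g : Matrix (Fin 2) (Fin 2) F)) hAB) i) j
  have hsurj : Function.Surjective (Matrix.GeneralLinearGroup.det (n := Fin 2) (R := F)) := by
    intro u
    refine ⟨Matrix.GeneralLinearGroup.mkOfDetNeZero !![(u : F), 0; 0, 1] (by simp), ?_⟩
    ext
    simp [Matrix.GeneralLinearGroup.mkOfDetNeZero]
  have hidx := Subgroup.index_mul_card (Matrix.GeneralLinearGroup.det (n := Fin 2) (R := F)).ker
  rw [Subgroup.index_ker, MonoidHom.range_eq_top.2 hsurj, Subgroup.card_top, hcard,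
    Matrix.card_GL_field, Nat.card_units, Nat.card_eq_fintype_card] at hidx
  have hq : 1 < Fintype.card F := Fintype.one_lt_card
  simp only [Fin.prod_univ_two, Fin.val_zero, Fin.val_one, pow_zero, pow_one] at hidx
  refine Nat.eq_of_mul_eq_mul_left (Nat.sub_pos_of_lt hq) (hidx.trans ?_)
  rw [show Fintype.card F ^ 2 - Fintype.card F = (Fintype.card F - 1) * Fintype.card F by
    rw [Nat.sub_mul, sq, one_mul]]
  ring

/-! ### Polynomial identities -/

section Quotient

variable {F : Type*} [Field F]

theorem x_ne_zero (i : Fin 2) : (x i : R F) ≠ 0 := X_ne_zero _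

theorem mul_exactQuot {a b : R F} (hab : b ∣ a) : b * exactQuot a b = a := by
  rw [exactQuot, dif_pos hab]
  exact hab.choose_spec.symm

end Quotient

section Relations

variable (F : Type*) [Field F] [Fintype F]

local notation "q" => Fintype.card F

theorem two_le_card : 2 ≤ q := Fintype.one_lt_card

variable {F} in
theorem add_pow_q (a b : R F) : (a + b) ^ q = a ^ q + b ^ q :=
  map_add (FiniteField.frobeniusAlgHom F (R F)) a b

variable {F} in
theorem sub_pow_q (a b : R F) : (a - b) ^ q = a ^ q - b ^ q :=
  map_sub (FiniteField.frobeniusAlgHom F (R F)) a b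

variable {F} in
theorem C_pow_q (a : F) : (C a : R F) ^ q = C a := by rw [← C_pow, FiniteField.pow_card]

theorem d_eq : d F = x 1 * x 0 ^ q - x 1 ^ q * x 0 := by simp [d, Matrix.det_fin_two_of]

theorem cNum_eq : cNum F = x 1 * x 0 ^ (q ^ 2) - x 1 ^ (q ^ 2) * x 0 := by
  simp [cNum, Matrix.det_fin_two_of]

/-- The product of the orbit of `x 0` under the translations `x 0 ↦ x 0 + a * x 1`. -/
noncomputable def orbitProd : R F := x 0 ^ q - x 0 * x 1 ^ (q - 1)

theorem d_eq_mul_orbitProd : d F = x 1 * orbitProd F := by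
  rw [d_eq, orbitProd]
  obtain ⟨n, hn⟩ : ∃ n, q = n + 1 := ⟨q - 1, by have := two_le_card F; omega⟩
  rw [hn, Nat.add_sub_cancel]
  ring

theorem x_zero_pow_ne : (x 0 : R F) ^ q ≠ x 0 * x 1 ^ (q - 1) := by
  intro hx
  have := congrArg (aeval (Sum.elim (fun i : Fin 2 => if i = 0 then (1 : F) else 0) fun _ => 0)) hx
  have h2 := two_le_card F
  simp [x, zero_pow (show q - 1 ≠ 0 by omega)] at this

theorem d_ne_zero : d F ≠ 0 := by
  rw [d_eq_mul_orbitProd]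
  exact mul_ne_zero (x_ne_zero 1) (sub_ne_zero.2 (x_zero_pow_ne F))

theorem orbitProd_pow_q {n : ℕ} (hn : q = n + 1) : orbitProd F ^ (n + 1) =
    x 0 ^ ((n + 1) * (n + 1)) - x 0 ^ (n + 1) * x 1 ^ (n * (n + 1)) := by
  rw [← hn, orbitProd, sub_pow_q, hn, mul_pow, Nat.add_sub_cancel, ← pow_mul, ← pow_mul]

theorem cNum_eq_mul : cNum F = d F * (orbitProd F ^ (q - 1) + x 1 ^ (q * (q - 1))) := by
  obtain ⟨n, hn⟩ : ∃ n, q = n + 1 := ⟨q - 1, by have := two_le_card F; omega⟩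
  have hN := orbitProd_pow_q F hn
  have hN' : orbitProd F = x 0 ^ (n + 1) - x 0 * x 1 ^ n := by
    rw [orbitProd, hn, Nat.add_sub_cancel]
  rw [cNum_eq, d_eq_mul_orbitProd, hn, Nat.add_sub_cancel]
  have : x 1 * orbitProd F * (orbitProd F ^ n + x 1 ^ ((n + 1) * n)) =
      x 1 * orbitProd F ^ (n + 1) + x 1 ^ (n * n + n + 1) * orbitProd F := by ring
  rw [this, hN, hN']
  ring

theorem d_mul_c : d F * c F = cNum F := mul_exactQuot ⟨_, cNum_eq_mul F⟩

theorem c_eq : c F = orbitProd F ^ (q - 1) + x 1 ^ (q * (q - 1)) :=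
  mul_left_cancel₀ (d_ne_zero F) (by rw [d_mul_c, cNum_eq_mul])

/-- The `x i` are roots of the Dickson polynomial `T ^ (q ^ 2) - c * T ^ q + d ^ (q - 1) * T`. -/
theorem x_pow_card_sq (i : Fin 2) :
    (x i : R F) ^ (q * q) = c F * x i ^ q - d F ^ (q - 1) * x i := by
  obtain ⟨n, hn⟩ : ∃ n, q = n + 1 := ⟨q - 1, by have := two_le_card F; omega⟩
  have hN := orbitProd_pow_q F hn
  have hN' : x 0 ^ (n + 1) = orbitProd F + x 0 * x 1 ^ n := by
    rw [orbitProd, hn, Nat.add_sub_cancel]; ring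
  rw [c_eq, d_eq_mul_orbitProd, hn, Nat.add_sub_cancel]
  fin_cases i
  · simp only [Fin.zero_eta]
    have h1 : x 0 ^ ((n + 1) * (n + 1)) =
        orbitProd F ^ (n + 1) + x 0 ^ (n + 1) * x 1 ^ (n * (n + 1)) := by
      rw [hN]; ring
    rw [h1, hN']
    ring
  · simp only [Fin.mk_one]
    ring

end Relations

/-! ### The action and the involution -/

section Action

variable {F : Type*} [Field F]

local notation "SL" => Matrix.SpecialLinearGroup (Fin 2) F

theorem act_x_zero (A B : SL) : act A B (x 0) = C (A.1 1 1) * x 0 - C (A.1 1 0) * x 1 := by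
  simp [act, x, Matrix.SpecialLinearGroup.coe_inv, Matrix.adjugate_fin_two, sub_eq_add_neg]

theorem act_x_one (A B : SL) : act A B (x 1) = C (A.1 0 0) * x 1 - C (A.1 0 1) * x 0 := by
  simp [act, x, Matrix.SpecialLinearGroup.coe_inv, Matrix.adjugate_fin_two, sub_eq_add_neg,
    add_comm]

theorem act_y (A B : SL) (i : Fin 2) :
    act A B (y i) = C (B.1 i 0) * y 0 + C (B.1 i 1) * y 1 := by
  simp [act, y]

theorem det_eq_one (A : SL) : A.1 0 0 * A.1 1 1 - A.1 0 1 * A.1 1 0 = 1 := by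
  rw [← Matrix.det_fin_two, A.2]

theorem C_det_eq_one (A : SL) :
    (C (A.1 0 0) * C (A.1 1 1) - C (A.1 0 1) * C (A.1 1 0) : R F) = 1 := by
  rw [← C_mul, ← C_mul, ← C_sub, det_eq_one, C_1]

@[simp] theorem invol_x (i : Fin 2) : invol (x i : R F) = y i.rev := by simp [invol, x]

@[simp] theorem invol_y (i : Fin 2) : invol (y i : R F) = x i.rev := by simp [invol, y]

@[simp] theorem rev_zero : (0 : Fin 2).rev = 1 := rfl

@[simp] theorem rev_one : (1 : Fin 2).rev = 0 := rfl

theorem algHom_ext_xy {S : Type*} [CommRing S] [Algebra F S] {φ ψ : R F →ₐ[F] S}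
    (hx : ∀ i, φ (x i) = ψ (x i)) (hy : ∀ i, φ (y i) = ψ (y i)) : φ = ψ := by
  apply MvPolynomial.algHom_ext
  rintro (i | i)
  · exact hx i
  · exact hy i

@[simp] theorem invol_invol (f : R F) : invol (invol f) = f := by
  have : (invol.comp invol : R F →ₐ[F] R F) = AlgHom.id F _ :=
    algHom_ext_xy (by intro i; simp) (by intro i; simp)
  exact DFunLike.congr_fun this f

/-- The automorphism of `SL₂` that negates the off-diagonal entries; it makes the involution
equivariant. -/
def twist (A : SL) : SL := ⟨!![A.1 0 0, -A.1 0 1; -A.1 1 0, A.1 1 1], by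
  rw [Matrix.det_fin_two_of]; linear_combination det_eq_one A⟩

theorem twist_apply (A : SL) : (twist A).1 = !![A.1 0 0, -A.1 0 1; -A.1 1 0, A.1 1 1] := rfl

theorem act_invol (A B : SL) (f : R F) : act A B (invol f) = invol (act (twist B) (twist A) f) := by
  have : (act A B).comp invol = invol.comp (act (twist B) (twist A)) := by
    refine algHom_ext_xy (Fin.forall_fin_two.2 ⟨?_, ?_⟩) (Fin.forall_fin_two.2 ⟨?_, ?_⟩)
    all_goals
      simp only [AlgHom.comp_apply, invol_x, invol_y, rev_zero, rev_one, act_x_zero, act_x_one,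
        act_y, twist_apply, map_add, map_sub, map_mul, algHom_C, algebraMap_eq]
      simp
    all_goals ring
  exact DFunLike.congr_fun this f

theorem invol_mem_invSL {f : R F} (hf : f ∈ invSL F) : invol f ∈ invSL F := fun A => by
  rw [act_invol, hf]

theorem adjoin_variables : Algebra.adjoin F {x 0, x 1, y 0, y 1} = (⊤ : Subalgebra F (R F)) := by
  rw [eq_top_iff, ← adjoin_range_X]
  apply Algebra.adjoin_mono
  rintro _ ⟨i | i, rfl⟩ <;> fin_cases i <;> simp [x, y]

variable (F) in
@[simp] theorem invol_u₀ : invol (u₀ F) = u₀ F := by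
  simp [u₀]
  ring

variable (F) in
theorem u₀_prime : Prime (u₀ F) := by
  rw [← irreducible_iff_prime]
  have := irreducible_sumSMulXSMulY (n := Fin 2) (R := F)
    (Finsupp.single 0 1 + Finsupp.single 1 1) ⟨0, by simp, 1, by simp, by simp⟩
    (fun r hr => isUnit_of_dvd_one (by simpa using hr 0))
  simpa [sumSMulXSMulY, map_add, u₀, x, y] using this

variable (F) in
theorem u₀_ne_zero : u₀ F ≠ 0 := (u₀_prime F).ne_zero

theorem act_u₀ (A : SL) : act A A (u₀ F) = u₀ F := by
  simp only [u₀, map_add, map_mul, act_x_zero, act_x_one, act_y]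
  linear_combination (x 0 * y 0 + x 1 * y 1) * C_det_eq_one A

end Action

section Relations

variable (F : Type*) [Field F] [Fintype F]

local notation "q" => Fintype.card F

local notation "SL" => Matrix.SpecialLinearGroup (Fin 2) F

/-! ### Invariance of the generators -/

variable {F}

theorem act_d (A B : SL) : act A B (d F) = d F := by
  rw [d_eq]
  simp only [map_sub, map_mul, map_pow, act_x_zero, act_x_one]
  simp only [sub_pow_q, mul_pow, C_pow_q]
  linear_combination (x 1 * x 0 ^ q - x 1 ^ q * x 0) * C_det_eq_one A

theorem act_cNum (A B : SL) : act A B (cNum F) = cNum F := by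
  rw [cNum_eq, sq]
  simp only [map_sub, map_mul, map_pow, act_x_zero, act_x_one]
  simp only [pow_mul, sub_pow_q, mul_pow, C_pow_q]
  linear_combination (x 1 * (x 0 ^ q) ^ q - (x 1 ^ q) ^ q * x 0) * C_det_eq_one A

theorem act_c (A B : SL) : act A B (c F) = c F := by
  apply mul_left_cancel₀ (d_ne_zero F)
  nth_rw 1 [← act_d A B]
  rw [← map_mul, d_mul_c, act_cNum]

theorem act_dStar (A B : SL) : act A B (dStar F) = dStar F := by
  rw [dStar, act_invol, act_d]

theorem act_cStar (A B : SL) : act A B (cStar F) = cStar F := by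
  rw [cStar, act_invol, act_c]

theorem act_u₁ (A : SL) : act A A (u₁ F) = u₁ F := by
  simp only [u₁, map_add, map_mul, map_pow, act_x_zero, act_x_one, act_y]
  simp only [sub_pow_q, mul_pow, C_pow_q]
  linear_combination (x 0 ^ q * y 0 + x 1 ^ q * y 1) * C_det_eq_one A

theorem act_u₁Star (A : SL) : act A A (u₁Star F) = u₁Star F := by
  rw [u₁Star, act_invol, act_u₁]

variable (F)

@[simp] theorem invol_d : invol (d F) = dStar F := rfl
@[simp] theorem invol_c : invol (c F) = cStar F := rfl
@[simp] theorem invol_dStar : invol (dStar F) = d F := invol_invol _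
@[simp] theorem invol_cStar : invol (cStar F) = c F := invol_invol _
@[simp] theorem invol_u₁ : invol (u₁ F) = u₁Star F := rfl
@[simp] theorem invol_u₁Star : invol (u₁Star F) = u₁ F := invol_invol _

/-! ### The invariants `h_s` -/

theorem dStar_eq : dStar F = y 0 * y 1 ^ q - y 0 ^ q * y 1 := by
  rw [dStar, d_eq]
  simp

theorem u₁Star_eq : u₁Star F = y 1 ^ q * x 1 + y 0 ^ q * x 0 := by
  rw [u₁Star, u₁]
  simp

theorem dStar_ne_zero : dStar F ≠ 0 := fun h0 =>
  d_ne_zero F (by rw [← invol_dStar, h0, map_zero])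

/-- The determinant of the product of the matrices with rows `(x₁, x₂)`, `(x₁ ^ q, x₂ ^ q)` and
columns `(y₁, y₂)`, `(y₁ ^ q, y₂ ^ q)`. -/
theorem u₁_mul_u₁Star : u₁ F * u₁Star F = u₀ F ^ (q + 1) + d F * dStar F := by
  have hu : u₀ F ^ q = x 0 ^ q * y 0 ^ q + x 1 ^ q * y 1 ^ q := by
    rw [u₀, add_pow_q, mul_pow, mul_pow]
  rw [pow_succ, hu, u₁Star_eq, u₁, d_eq, dStar_eq, u₀]
  ring

/-- The recursion for the numerators of the `h_s`; `u₀` being prime and coprime to `dStar`, it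
gives the divisibility of these numerators by `u₀ ^ q`. -/
theorem hNum_succ (s : ℕ) (hs : s + 1 < q) :
    dStar F * hNum F (s + 1) =
      u₁ F * hNum F s - u₀ F ^ q * (u₀ F * u₁Star F ^ (q - (s + 1)) * d F ^ s) := by
  obtain ⟨n, hn⟩ : ∃ n, q = s + n + 2 := ⟨q - s - 2, by omega⟩
  have key := u₁_mul_u₁Star F
  simp only [hNum]
  rw [show q - (s + 1) - 1 = n by omega, show q - (s + 1) = n + 1 by omega,
    show q - s - 1 = n + 1 by omega, show q - s = n + 2 by omega]
  linear_combination (-u₁Star F ^ (n + 1) * d F ^ s) * key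

theorem u₁Star_pow_q : u₁Star F ^ q = cStar F * u₀ F ^ q - dStar F ^ (q - 1) * u₁ F := by
  have hy : ∀ i : Fin 2, (y i ^ q) ^ q = cStar F * y i ^ q - dStar F ^ (q - 1) * y i := by
    intro i
    have := congrArg invol (x_pow_card_sq F i.rev)
    simpa [pow_mul] using this
  rw [u₁Star_eq, add_pow_q, mul_pow, mul_pow, hy, hy, u₀, add_pow_q, mul_pow, mul_pow, u₁]
  ring

theorem hNum_zero : hNum F 0 = u₀ F ^ q * cStar F := by
  simp only [hNum]
  rw [Nat.sub_zero, u₁Star_pow_q]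
  ring

theorem not_u₀_dvd_dStar : ¬ u₀ F ∣ dStar F := by
  rintro ⟨f, hf⟩
  -- kill the `x`'s
  let φ : R F →ₐ[F] R F := aeval (Sum.elim (fun _ => 0) y)
  have hx (i) : φ (x i) = 0 := by simp [φ, x]
  have hy (i) : φ (y i) = y i := by simp [φ, y]
  have h1 : φ (u₀ F) = 0 := by simp [u₀, hx]
  have h2 : φ (dStar F) = dStar F := by simp [dStar_eq, hy]
  apply dStar_ne_zero F
  rw [← h2, hf, map_mul, h1, zero_mul]

theorem u₀_pow_dvd_hNum (s : ℕ) (hs : s < q) : u₀ F ^ q ∣ hNum F s := by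
  induction s with
  | zero => exact ⟨_, hNum_zero F⟩
  | succ s ih =>
    refine (u₀_prime F).pow_dvd_of_dvd_mul_left q (not_u₀_dvd_dStar F) ?_
    rw [hNum_succ F s hs]
    exact dvd_sub ((ih (by omega)).mul_left _) (dvd_mul_right _ _)

theorem u₀_pow_mul_h {s : ℕ} (hs : s < q) : u₀ F ^ q * h F s = hNum F s :=
  mul_exactQuot (u₀_pow_dvd_hNum F s hs)

variable {F} in
theorem eq_of_u₀_pow_mul_eq {f g : R F} (hfg : u₀ F ^ q * f = u₀ F ^ q * g) : f = g :=
  mul_left_cancel₀ (pow_ne_zero q (u₀_ne_zero F)) hfg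

theorem h_zero : h F 0 = cStar F :=
  eq_of_u₀_pow_mul_eq (by rw [u₀_pow_mul_h F (by have := two_le_card F; omega), hNum_zero])

theorem invol_h {s : ℕ} (hs : s < q) : invol (h F s) = h F (q - 1 - s) := by
  apply eq_of_u₀_pow_mul_eq
  rw [u₀_pow_mul_h F (show q - 1 - s < q by omega)]
  nth_rw 1 [← invol_u₀]
  rw [← map_pow, ← map_mul, u₀_pow_mul_h F hs, hNum, hNum]
  simp only [map_add, map_mul, map_pow, invol_u₁, invol_dStar, invol_u₁Star, invol_d]
  rw [show q - (q - 1 - s) - 1 = s by omega, show q - 1 - s + 1 = q - s by omega,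
    show q - (q - 1 - s) = s + 1 by omega, show q - s - 1 = q - 1 - s by omega]
  ring

theorem h_last : h F (q - 1) = c F := by
  have := invol_h F (s := 0) (by have := two_le_card F; omega)
  rw [Nat.sub_zero] at this
  rw [← this, h_zero, invol_cStar]

theorem u₁_mul_h {s : ℕ} (hs : s + 1 < q) :
    u₁ F * h F s = dStar F * h F (s + 1) + u₀ F * u₁Star F ^ (q - (s + 1)) * d F ^ s := by
  apply eq_of_u₀_pow_mul_eq
  have h1 := u₀_pow_mul_h F (show s < q by omega)
  have h2 := u₀_pow_mul_h F hs
  have h3 := hNum_succ F s hs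
  linear_combination u₁ F * h1 - dStar F * h2 - h3

theorem u₁_pow_q : u₁ F ^ q = c F * u₀ F ^ q - d F ^ (q - 1) * u₁Star F := by
  simpa using congrArg invol (u₁Star_pow_q F)

theorem act_h (A : SL) {s : ℕ} (hs : s < q) : act A A (h F s) = h F s := by
  apply eq_of_u₀_pow_mul_eq
  nth_rw 1 [← act_u₀ A]
  rw [← map_pow, ← map_mul, u₀_pow_mul_h F hs, hNum]
  simp only [map_add, map_mul, map_pow, act_u₁, act_dStar, act_u₁Star, act_d]

end Relations

section Faithful

variable {F : Type*} [Field F]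

local notation "SL" => Matrix.SpecialLinearGroup (Fin 2) F

/-! ### Faithfulness of the action -/

theorem eq_of_act_x_eq {A B A' B' : SL} (hA : ∀ i, act A B (x i) = act A' B' (x i)) : A = A' := by
  have h0 := hA 0
  have h1 := hA 1
  rw [act_x_zero, act_x_zero] at h0
  rw [act_x_one, act_x_one] at h1
  let φ (i : Fin 2) : R F →ₐ[F] F := aeval (Sum.elim (Pi.single i 1) 0)
  have e (i : Fin 2) := congrArg (φ i) h0
  have e' (i : Fin 2) := congrArg (φ i) h1
  have h00 := e 0
  have h01 := e 1
  have h10 := e' 0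
  have h11 := e' 1
  simp [φ, x] at h00 h01 h10 h11
  ext i j
  fin_cases i <;> fin_cases j <;> assumption

theorem eq_of_act_y_eq {A B A' B' : SL} (hB : ∀ i, act A B (y i) = act A' B' (y i)) : B = B' := by
  let φ (i : Fin 2) : R F →ₐ[F] F := aeval (Sum.elim 0 (Pi.single i 1))
  ext i j
  have e := congrArg (φ j) (hB i)
  rw [act_y, act_y] at e
  fin_cases j <;> simpa [φ, y] using e

end Faithful

section XBasis

variable (F : Type*) [Field F] [Fintype F]

local notation "q" => Fintype.card F

local notation "SL" => Matrix.SpecialLinearGroup (Fin 2) F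

/-! ### Generators of the polynomial ring over the Dickson invariants -/

/-- The index set of `dicksonGen`, of cardinality `q * (q ^ 2 - 1)`. -/
abbrev DicksonIndex : Type := Fin q × (Fin (q * (q - 1)) ⊕ Fin (q - 1))

/-- Powers of `x 1` of exponent below `q * (q - 1)` and powers `N ^ j`, `1 ≤ j ≤ q - 1`, of the
orbit product `N`: they generate `F[x 1, N]` as a module over `F[d, c] = F[x 1 * N, N ^ (q - 1) +
x 1 ^ (q * (q - 1))]`. -/
noncomputable def orbitGen : Fin (q * (q - 1)) ⊕ Fin (q - 1) → R F
  | .inl j => x 1 ^ (j : ℕ)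
  | .inr j => orbitProd F ^ ((j : ℕ) + 1)

/-- Generators of `F[x 0, x 1]` as a module over `F[d, c]`: the generators of `F[x 1, N]` times the
powers of `x 0` below `q`, `x 0` being integral of degree `q` over `F[x 1, N]`. -/
noncomputable def dicksonGen (i : DicksonIndex F) : R F := x 0 ^ (i.1 : ℕ) * orbitGen F i.2

theorem card_dicksonIndex : Fintype.card (DicksonIndex F) = q * (q ^ 2 - 1) := by
  simp only [Fintype.card_prod, Fintype.card_sum, Fintype.card_fin]
  obtain ⟨n, hn⟩ : ∃ n, q = n + 1 := ⟨q - 1, by have := two_le_card F; omega⟩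
  rw [hn, Nat.add_sub_cancel]
  congr 1
  rw [eq_comm, Nat.sub_eq_iff_eq_add (Nat.one_le_pow _ _ (by omega))]
  ring

theorem one_mem_range_orbitGen : ∃ j, orbitGen F j = 1 :=
  have hq := two_le_card F
  ⟨.inl ⟨0, Nat.mul_pos (by omega) (by omega)⟩, by simp [orbitGen]⟩

theorem exists_dicksonGen_eq_one : ∃ i, dicksonGen F i = 1 := by
  obtain ⟨j, hj⟩ := one_mem_range_orbitGen F
  exact ⟨(⟨0, by have := two_le_card F; omega⟩, j), by simp [dicksonGen, hj]⟩

variable {F} {A : Subalgebra F (R F)}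

theorem x_one_pow_mem (hc : c F ∈ A) {n : ℕ} (hn : n ≤ q * (q - 1)) :
    x 1 ^ n ∈ Submodule.span A (Set.range (orbitGen F)) := by
  have hq := two_le_card F
  rcases hn.lt_or_eq with hn | rfl
  · exact Submodule.subset_span ⟨.inl ⟨n, hn⟩, rfl⟩
  · have : x 1 ^ (q * (q - 1)) = c F * 1 - orbitProd F ^ (q - 1) := by rw [c_eq]; ring
    rw [this]
    refine Submodule.sub_mem _ (mul_mem_of_mem _ hc ?_) ?_
    · obtain ⟨j, hj⟩ := one_mem_range_orbitGen F
      exact Submodule.subset_span ⟨j, hj⟩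
    · exact Submodule.subset_span ⟨.inr ⟨q - 2, by omega⟩, by
        simp only [orbitGen]; congr 1; omega⟩

theorem orbitProd_pow_mem (hd : d F ∈ A) (hc : c F ∈ A) {n : ℕ} (hn : n ≤ q) :
    orbitProd F ^ n ∈ Submodule.span A (Set.range (orbitGen F)) := by
  have hq := two_le_card F
  rcases Nat.eq_zero_or_pos n with rfl | hn0
  · simpa using x_one_pow_mem hc (Nat.zero_le _)
  rcases hn.lt_or_eq with hn | rfl
  · exact Submodule.subset_span ⟨.inr ⟨n - 1, by omega⟩, by simp only [orbitGen]; congr 1; omega⟩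
  · have hpos : 0 < q * (q - 1) := Nat.mul_pos (by omega) (by omega)
    have : orbitProd F ^ q = c F * orbitProd F ^ 1 - d F * x 1 ^ (q * (q - 1) - 1) := by
      rw [c_eq, d_eq_mul_orbitProd]
      obtain ⟨m, hm⟩ : ∃ m, q * (q - 1) = m + 1 := ⟨q * (q - 1) - 1, by omega⟩
      rw [hm, Nat.add_sub_cancel]
      nth_rw 1 [show q = (q - 1) + 1 by omega]
      ring
    rw [this]
    refine Submodule.sub_mem _ (mul_mem_of_mem _ hc ?_)
      (mul_mem_of_mem _ hd (x_one_pow_mem hc (by omega)))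
    exact Submodule.subset_span ⟨.inr ⟨0, by omega⟩, by simp [orbitGen]⟩

theorem x_one_mul_mem_span_orbitGen (hd : d F ∈ A) (hc : c F ∈ A) {m : R F}
    (hm : m ∈ Submodule.span A (Set.range (orbitGen F))) :
    x 1 * m ∈ Submodule.span A (Set.range (orbitGen F)) := by
  refine mul_mem_of_mem_span _ _ _ ?_ hm
  rintro _ ⟨j | j, rfl⟩ <;> simp only [orbitGen]
  · rw [← pow_succ']
    exact x_one_pow_mem hc j.2
  · rw [pow_succ', ← mul_assoc, ← d_eq_mul_orbitProd]
    exact mul_mem_of_mem _ hd (orbitProd_pow_mem hd hc (by omega))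

theorem orbitProd_mul_mem_span_orbitGen (hd : d F ∈ A) (hc : c F ∈ A) {m : R F}
    (hm : m ∈ Submodule.span A (Set.range (orbitGen F))) :
    orbitProd F * m ∈ Submodule.span A (Set.range (orbitGen F)) := by
  refine mul_mem_of_mem_span _ _ _ ?_ hm
  rintro _ ⟨⟨j, hj⟩ | j, rfl⟩ <;> simp only [orbitGen]
  · rcases j with _ | j
    · simpa using orbitProd_pow_mem hd hc (n := 1) (by have := two_le_card F; omega)
    · rw [show orbitProd F * x 1 ^ (j + 1) = d F * x 1 ^ j by rw [d_eq_mul_orbitProd]; ring]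
      exact mul_mem_of_mem _ hd (x_one_pow_mem hc (by omega))
  · rw [← pow_succ']
    exact orbitProd_pow_mem hd hc (by omega)

theorem x_zero_pow_mul_mem {m : R F} (hm : m ∈ Submodule.span A (Set.range (orbitGen F))) {n : ℕ}
    (hn : n < q) : x 0 ^ n * m ∈ Submodule.span A (Set.range (dicksonGen F)) := by
  refine mul_mem_of_mem_span _ _ _ ?_ hm
  rintro _ ⟨j, rfl⟩
  exact Submodule.subset_span ⟨(⟨n, hn⟩, j), rfl⟩

theorem x_mul_mem_span_dicksonGen (hd : d F ∈ A) (hc : c F ∈ A) (i : Fin 2) {m : R F}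
    (hm : m ∈ Submodule.span A (Set.range (dicksonGen F))) :
    x i * m ∈ Submodule.span A (Set.range (dicksonGen F)) := by
  have hq := two_le_card F
  refine mul_mem_of_mem_span _ _ _ ?_ hm
  rintro _ ⟨⟨⟨n, hn⟩, j⟩, rfl⟩
  have hj : orbitGen F j ∈ Submodule.span A (Set.range (orbitGen F)) :=
    Submodule.subset_span ⟨j, rfl⟩
  simp only [dicksonGen]
  revert i
  refine Fin.forall_fin_two.2 ⟨?_, ?_⟩
  · rw [← mul_assoc, ← pow_succ']
    rcases (show n + 1 ≤ q from hn).lt_or_eq with hn | hn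
    · exact x_zero_pow_mul_mem hj hn
    -- `x 0 ^ q = N + x 0 * x 1 ^ (q - 1)`
    · rw [hn, show x 0 ^ q * orbitGen F j = x 0 ^ 0 * (orbitProd F * orbitGen F j) +
        x 0 ^ 1 * (x 1 ^ (q - 1) * orbitGen F j) by rw [orbitProd]; ring]
      refine Submodule.add_mem _
        (x_zero_pow_mul_mem (orbitProd_mul_mem_span_orbitGen hd hc hj) (by omega))
        (x_zero_pow_mul_mem ?_ (by omega))
      have hpow (k : ℕ) :
          x 1 ^ k * orbitGen F j ∈ Submodule.span A (Set.range (orbitGen F)) := by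
        induction k with
        | zero => simpa using hj
        | succ k ih =>
          rw [pow_succ', mul_assoc]
          exact x_one_mul_mem_span_orbitGen hd hc ih
      exact hpow _
  · rw [show x 1 * (x 0 ^ n * orbitGen F j) = x 0 ^ n * (x 1 * orbitGen F j) by ring]
    exact x_zero_pow_mul_mem (x_one_mul_mem_span_orbitGen hd hc hj) hn

theorem one_mem_span_dicksonGen : 1 ∈ Submodule.span A (Set.range (dicksonGen F)) :=
  let ⟨i, hi⟩ := exists_dicksonGen_eq_one F
  Submodule.subset_span ⟨i, hi⟩

/-! ### The invariants of `SL₂ × SL₂` -/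

variable (F) in
/-- The algebra generated by the four Dickson invariants. -/
noncomputable def dicksonAlgebra : Subalgebra F (R F) :=
  Algebra.adjoin F {d F, c F, dStar F, cStar F}

variable (F) in
theorem dicksonAlgebra_eq_adjoin_range :
    dicksonAlgebra F = Algebra.adjoin F (Set.range ![d F, c F, dStar F, cStar F]) := by
  simp only [dicksonAlgebra, Matrix.range_cons, Matrix.range_empty, Set.union_empty,
    Set.singleton_union]

theorem dicksonAlgebra_le_invSLSL : dicksonAlgebra F ≤ invSLSL F := by
  refine Algebra.adjoin_le ?_
  rintro _ (rfl | rfl | rfl | rfl) A B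
  exacts [act_d A B, act_c A B, act_dStar A B, act_cStar A B]

theorem d_mem : d F ∈ dicksonAlgebra F := Algebra.subset_adjoin (by simp)
theorem c_mem : c F ∈ dicksonAlgebra F := Algebra.subset_adjoin (by simp)
theorem dStar_mem : dStar F ∈ dicksonAlgebra F := Algebra.subset_adjoin (by simp)
theorem cStar_mem : cStar F ∈ dicksonAlgebra F := Algebra.subset_adjoin (by simp)

theorem invol_mem_dicksonAlgebra {f : R F} (hf : f ∈ dicksonAlgebra F) :
    invol f ∈ dicksonAlgebra F := by
  have : dicksonAlgebra F ≤ (dicksonAlgebra F).comap invol := by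
    refine Algebra.adjoin_le ?_
    rintro _ (rfl | rfl | rfl | rfl) <;> rw [SetLike.mem_coe, Subalgebra.mem_comap]
    exacts [dStar_mem, cStar_mem, by simpa using d_mem, by simpa using c_mem]
  exact this hf

/-- A span over the Dickson algebra is stable under the involution as soon as the images of its
generators lie in it. -/
theorem invol_mem_of_mem_span {s : Set (R F)} {E : Submodule (dicksonAlgebra F) (R F)} (a : R F)
    (hs : ∀ m ∈ s, a * invol m ∈ E) {m : R F} (hm : m ∈ Submodule.span (dicksonAlgebra F) s) :
    a * invol m ∈ E := by
  induction hm using Submodule.span_induction with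
  | mem m hm => exact hs m hm
  | zero => simp
  | add m m' _ _ h1 h2 => rw [map_add, mul_add]; exact E.add_mem h1 h2
  | smul r m _ h1 =>
    rw [Subalgebra.smul_def, smul_eq_mul, map_mul, mul_left_comm]
    exact mul_mem_of_mem E (invol_mem_dicksonAlgebra r.2) h1

variable (F) in
/-- Generators of `F[x 0, x 1, y 0, y 1]` over the Dickson algebra. -/
noncomputable def dicksonGen₂ (i : DicksonIndex F × DicksonIndex F) : R F :=
  dicksonGen F i.1 * invol (dicksonGen F i.2)

variable (F) in
theorem span_dicksonGen₂ :
    Submodule.span (dicksonAlgebra F) (Set.range (dicksonGen₂ F)) = ⊤ := by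
  have hgen : ∀ i : Fin 2,
      (∀ m ∈ Submodule.span (dicksonAlgebra F) (Set.range (dicksonGen₂ F)),
        x i * m ∈ Submodule.span (dicksonAlgebra F) (Set.range (dicksonGen₂ F))) ∧
      (∀ m ∈ Submodule.span (dicksonAlgebra F) (Set.range (dicksonGen₂ F)),
        y i * m ∈ Submodule.span (dicksonAlgebra F) (Set.range (dicksonGen₂ F))) := by
    intro i
    refine ⟨fun m => mul_mem_of_mem_span _ _ _ ?_, fun m => mul_mem_of_mem_span _ _ _ ?_⟩
    · rintro _ ⟨⟨j, k⟩, rfl⟩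
      have : ∀ m ∈ Submodule.span (dicksonAlgebra F) (Set.range (dicksonGen F)),
          invol (dicksonGen F k) * m ∈
            Submodule.span (dicksonAlgebra F) (Set.range (dicksonGen₂ F)) := by
        refine fun m => mul_mem_of_mem_span _ _ _ ?_
        rintro _ ⟨j', rfl⟩
        exact Submodule.subset_span ⟨(j', k), mul_comm _ _⟩
      have := this _ (x_mul_mem_span_dicksonGen d_mem c_mem i (Submodule.subset_span ⟨j, rfl⟩))
      simp only [dicksonGen₂]
      rwa [← mul_assoc, mul_comm]
    · rintro _ ⟨⟨j, k⟩, rfl⟩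
      have := invol_mem_of_mem_span (E := Submodule.span (dicksonAlgebra F)
          (Set.range (dicksonGen₂ F))) (dicksonGen F j) ?_
        (x_mul_mem_span_dicksonGen d_mem c_mem i.rev (Submodule.subset_span ⟨k, rfl⟩))
      · simpa [dicksonGen₂, mul_left_comm] using this
      · rintro _ ⟨k', rfl⟩
        exact Submodule.subset_span ⟨(j, k'), rfl⟩
  rw [eq_top_iff]
  intro f _
  obtain ⟨i, hi⟩ := exists_dicksonGen_eq_one F
  have h1 : (1 : R F) ∈ Submodule.span (dicksonAlgebra F) (Set.range (dicksonGen₂ F)) :=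
    Submodule.subset_span ⟨(i, i), by simp [dicksonGen₂, hi]⟩
  have hf : f ∈ Algebra.adjoin F {x 0, x 1, y 0, y 1} := by
    rw [adjoin_variables]; exact Algebra.mem_top
  rw [← mul_one f]
  refine mul_mem_of_mem_adjoin _ _ ?_ hf 1 h1
  rintro _ (rfl | rfl | rfl | rfl)
  exacts [(hgen 0).1, (hgen 1).1, (hgen 0).2, (hgen 1).2]

variable (F) in
theorem invSLSL_eq : invSLSL F = dicksonAlgebra F := by
  classical
  refine le_antisymm (fun f hf => ?_) dicksonAlgebra_le_invSLSL
  obtain ⟨i, hi⟩ := exists_dicksonGen_eq_one F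
  have hcard : Fintype.card (DicksonIndex F × DicksonIndex F) = Fintype.card (SL × SL) := by
    rw [Fintype.card_prod (DicksonIndex F), Fintype.card_prod SL, card_dicksonIndex,
      ← natCard_specialLinearGroup, Nat.card_eq_fintype_card]
  refine mem_of_mem_span_of_invariant hcard (fun g => act g.1 g.2) ⊤ ?_ (dicksonGen₂ F)
    (dicksonAlgebra F) (fun a ha g => dicksonAlgebra_le_invSLSL ha g.1 g.2)
    (fun m _ => by rw [span_dicksonGen₂]; trivial) (i, i) (by simp [dicksonGen₂, hi]) f
    (fun g => hf g.1 g.2) (by rw [span_dicksonGen₂]; trivial)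
  rintro ⟨A, B⟩ ⟨A', B'⟩ hg
  exact Prod.ext (eq_of_act_x_eq fun i => hg _ trivial) (eq_of_act_y_eq fun i => hg _ trivial)

variable (F) in
theorem algebraicIndependent_dickson :
    AlgebraicIndependent F ![d F, c F, dStar F, cStar F] := by
  have hfin : Module.Finite (dicksonAlgebra F) (R F) :=
    ⟨⟨(Set.finite_range (dicksonGen₂ F)).toFinset, by simp [span_dicksonGen₂]⟩⟩
  have : Algebra.IsIntegral (dicksonAlgebra F) (R F) := inferInstance
  have halg : Algebra.IsAlgebraic (dicksonAlgebra F) (R F) := inferInstance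
  rw [dicksonAlgebra_eq_adjoin_range] at halg
  have hle : Cardinal.lift (Cardinal.mk (Fin 4)) ≤ Cardinal.lift (Algebra.trdeg F (R F)) := by
    rw [MvPolynomial.trdeg_of_isDomain]
    simp
  exact (Algebra.IsAlgebraic.isTranscendenceBasis_of_lift_le_trdeg_of_finite F
    (x := ![d F, c F, dStar F, cStar F]) hle).1

end XBasis

section BasisModule

variable (F : Type*) [Field F] [Fintype F]

local notation "q" => Fintype.card F

local notation "SL" => Matrix.SpecialLinearGroup (Fin 2) F

/-! ### The module spanned by the basis elements -/

/-- The module spanned by the elements `basisElt F i` over the Dickson algebra. -/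
noncomputable def basisModule : Submodule (dicksonAlgebra F) (R F) :=
  Submodule.span (dicksonAlgebra F) (Set.range (basisElt F))

local notation "M" => basisModule F

variable {F}

theorem pow_mul_pow_mem {i j : ℕ} (hi : i < q) (hj : j < q) : u₁Star F ^ i * u₁ F ^ j ∈ M :=
  Submodule.subset_span ⟨.inl (⟨i, hi⟩, ⟨j, hj⟩), rfl⟩

theorem pow_mul_pow_mul_pow_mem {i j k : ℕ} (hi : i < q - 1) (hj : j < q - 1) (hk : k ≤ q) :
    u₁Star F ^ i * u₁ F ^ j * u₀ F ^ k ∈ M := by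
  rcases k with _ | k
  · simpa using pow_mul_pow_mem (F := F) (i := i) (j := j) (by omega) (by omega)
  · exact Submodule.subset_span ⟨.inr (.inl (⟨i, hi⟩, ⟨j, hj⟩, ⟨k, hk⟩)), rfl⟩

theorem u₀_pow_mem {k : ℕ} (hk : k ≤ q) : u₀ F ^ k ∈ M := by
  have hq := two_le_card F
  simpa using pow_mul_pow_mul_pow_mem (F := F) (i := 0) (j := 0) (by omega) (by omega) hk

theorem h_mul_pow_mem {s k : ℕ} (hs : s < q) (hk : k < q) : h F s * u₀ F ^ k ∈ M := by
  rcases s with _ | s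
  · rw [h_zero]
    exact mul_mem_of_mem _ cStar_mem (u₀_pow_mem hk.le)
  by_cases hs' : s < q - 2
  · exact Submodule.subset_span ⟨.inr (.inr (⟨s, hs'⟩, ⟨k, hk⟩)), rfl⟩
  · rw [show s + 1 = q - 1 by omega, h_last]
    exact mul_mem_of_mem _ c_mem (u₀_pow_mem hk.le)

theorem invol_mem_basisModule {m : R F} (hm : m ∈ M) : invol m ∈ M := by
  rw [← one_mul (invol m)]
  refine invol_mem_of_mem_span 1 ?_ hm
  rintro _ ⟨⟨i, j⟩ | ⟨i, j, k⟩ | ⟨s, k⟩, rfl⟩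
  · simpa [basisElt, mul_comm] using pow_mul_pow_mem j.2 i.2
  · simpa [basisElt, mul_comm] using pow_mul_pow_mul_pow_mem j.2 i.2 (k := k + 1) k.2
  · have hs : (s : ℕ) + 1 < q := by omega
    simpa [basisElt, invol_h F hs] using
      h_mul_pow_mem (F := F) (s := q - 1 - (s + 1)) (by omega) k.2

theorem u₁_pow_mem {j : ℕ} (hj : j ≤ q) : u₁ F ^ j ∈ M := by
  have hq := two_le_card F
  rcases hj.lt_or_eq with hj | rfl
  · simpa using pow_mul_pow_mem (F := F) (i := 0) (by omega) hj
  · rw [u₁_pow_q]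
    refine Submodule.sub_mem _ (mul_mem_of_mem _ c_mem (u₀_pow_mem le_rfl))
      (mul_mem_of_mem _ (pow_mem d_mem _) ?_)
    simpa using pow_mul_pow_mem (F := F) (i := 1) (j := 0) (by omega) (by omega)

theorem u₁Star_pow_mem {j : ℕ} (hj : j ≤ q) : u₁Star F ^ j ∈ M := by
  simpa using invol_mem_basisModule (u₁_pow_mem hj)

theorem h_mul_u₁_pow_mem {j : ℕ} (hj : j < q) {s : ℕ} (hs : 0 < s) (hs' : s < q) :
    h F s * u₁ F ^ j ∈ M := by
  induction j generalizing s with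
  | zero => simpa using h_mul_pow_mem (F := F) (k := 0) hs' (by omega)
  | succ j ih =>
    rcases (show s + 1 ≤ q from hs').lt_or_eq with hs1 | hs1
    · have : h F s * u₁ F ^ (j + 1) = dStar F * (h F (s + 1) * u₁ F ^ j) +
          d F ^ s * (u₁Star F ^ (q - (s + 1)) * u₁ F ^ j * u₀ F ^ 1) := by
        linear_combination u₁ F ^ j * u₁_mul_h F hs1
      rw [this]
      exact Submodule.add_mem _ (mul_mem_of_mem _ dStar_mem (ih (by omega) (by omega) hs1))
        (mul_mem_of_mem _ (pow_mem d_mem _)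
          (pow_mul_pow_mul_pow_mem (by omega) (by omega) (by omega)))
    · rw [show s = q - 1 by omega, h_last]
      exact mul_mem_of_mem _ c_mem (u₁_pow_mem hj.le)

theorem u₀_mul_u₁Star_pow_mem {j : ℕ} (hj : j < q) :
    u₀ F * (u₁Star F ^ (q - 1) * u₁ F ^ j) ∈ M := by
  have hq := two_le_card F
  -- the case `s = 0` of the recursion for `h_s`, as `h_0 = cStar`
  have : u₀ F * (u₁Star F ^ (q - 1) * u₁ F ^ j) =
      cStar F * u₁ F ^ (j + 1) - dStar F * (h F 1 * u₁ F ^ j) := by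
    have := u₁_mul_h F (s := 0) (by omega)
    rw [h_zero, zero_add, pow_zero, mul_one] at this
    linear_combination -u₁ F ^ j * this
  rw [this]
  exact Submodule.sub_mem _ (mul_mem_of_mem _ cStar_mem (u₁_pow_mem hj))
    (mul_mem_of_mem _ dStar_mem (h_mul_u₁_pow_mem hj one_pos (by omega)))

/-- The module spanned by the basis elements is stable under `u₀`. Only the basis elements of
extremal exponents need an argument, which uses the relations for `u₁ * u₁Star`, `u₁ * h_s` and
`u₀ ^ q * h_s`. -/
theorem u₀_mul_mem {m : R F} (hm : m ∈ M) : u₀ F * m ∈ M := by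
  have hq := two_le_card F
  refine mul_mem_of_mem_span _ _ _ ?_ hm
  rintro _ ⟨⟨⟨i, hi⟩, ⟨j, hj⟩⟩ | ⟨⟨i, hi⟩, ⟨j, hj⟩, ⟨k, hk⟩⟩ | ⟨⟨s, hs⟩, ⟨k, hk⟩⟩, rfl⟩ <;>
    simp only [basisElt]
  · by_cases hi' : i = q - 1
    · rw [hi']
      exact u₀_mul_u₁Star_pow_mem hj
    by_cases hj' : j = q - 1
    · have := invol_mem_basisModule (u₀_mul_u₁Star_pow_mem hi)
      simpa [hj', mul_comm] using this
    · rw [mul_comm]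
      simpa using pow_mul_pow_mul_pow_mem (F := F) (i := i) (j := j) (k := 1)
        (by omega) (by omega) (by omega)
  · rcases (show k + 1 ≤ q from hk).lt_or_eq with hk' | hk'
    · rw [mul_comm, mul_assoc, ← pow_succ]
      exact pow_mul_pow_mul_pow_mem hi hj (by omega)
    · have : u₀ F * (u₁Star F ^ i * u₁ F ^ j * u₀ F ^ (k + 1)) =
          u₁Star F ^ (i + 1) * u₁ F ^ (j + 1) - d F * dStar F * (u₁Star F ^ i * u₁ F ^ j) := by
        have := u₁_mul_u₁Star F
        rw [hk']
        linear_combination (-u₁Star F ^ i * u₁ F ^ j) * this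
      rw [this]
      exact Submodule.sub_mem _ (pow_mul_pow_mem (by omega) (by omega))
        (mul_mem_of_mem _ (mul_mem d_mem dStar_mem) (pow_mul_pow_mem (by omega) (by omega)))
  · rcases (show k + 1 ≤ q from hk).lt_or_eq with hk' | hk'
    · rw [mul_comm, mul_assoc, ← pow_succ]
      exact h_mul_pow_mem (by omega) hk'
    · have : u₀ F * (h F (s + 1) * u₀ F ^ k) = hNum F (s + 1) := by
        rw [← u₀_pow_mul_h F (show s + 1 < q by omega), ← hk']
        ring
      rw [this, hNum, mul_comm, mul_comm (u₁Star F ^ _)]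
      exact Submodule.add_mem _
        (mul_mem_of_mem _ (pow_mem dStar_mem _) (u₁_pow_mem (by omega)))
        (mul_mem_of_mem _ (pow_mem d_mem _) (u₁Star_pow_mem (by omega)))

theorem u₀_pow_mul_mem {m : R F} (hm : m ∈ M) (k : ℕ) : u₀ F ^ k * m ∈ M := by
  induction k with
  | zero => simpa using hm
  | succ k ih => rw [pow_succ', mul_assoc]; exact u₀_mul_mem ih

theorem u₁_mul_mem {m : R F} (hm : m ∈ M) : u₁ F * m ∈ M := by
  have hq := two_le_card F
  refine mul_mem_of_mem_span _ _ _ ?_ hm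
  rintro _ ⟨⟨⟨i, hi⟩, ⟨j, hj⟩⟩ | ⟨⟨i, hi⟩, ⟨j, hj⟩, ⟨k, hk⟩⟩ | ⟨⟨s, hs⟩, ⟨k, hk⟩⟩, rfl⟩ <;>
    simp only [basisElt]
  · rw [mul_left_comm, ← pow_succ']
    rcases (show j + 1 ≤ q from hj).lt_or_eq with hj' | hj'
    · exact pow_mul_pow_mem hi hj'
    · have : u₁Star F ^ i * u₁ F ^ (j + 1) =
          c F * (u₀ F ^ q * u₁Star F ^ i) - d F ^ (q - 1) * u₁Star F ^ (i + 1) := by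
        rw [hj', u₁_pow_q]
        ring
      rw [this]
      exact Submodule.sub_mem _
        (mul_mem_of_mem _ c_mem (u₀_pow_mul_mem (u₁Star_pow_mem hi.le) _))
        (mul_mem_of_mem _ (pow_mem d_mem _) (u₁Star_pow_mem hi))
  · rw [show u₁ F * (u₁Star F ^ i * u₁ F ^ j * u₀ F ^ (k + 1)) =
      u₀ F ^ (k + 1) * (u₁Star F ^ i * u₁ F ^ (j + 1)) by ring]
    exact u₀_pow_mul_mem (pow_mul_pow_mem (by omega) (by omega)) _
  · rw [show u₁ F * (h F (s + 1) * u₀ F ^ k) = u₀ F ^ k * (h F (s + 1) * u₁ F ^ 1) by ring]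
    exact u₀_pow_mul_mem (h_mul_u₁_pow_mem (by omega) (by omega) (by omega)) _

theorem one_mem_basisModule : (1 : R F) ∈ M := by
  simpa using u₀_pow_mem (F := F) (k := 0) (Nat.zero_le _)

theorem adjoin_le_basisModule {f : R F}
    (hf : f ∈ Algebra.adjoin F {d F, c F, u₀ F, u₁ F}) : f ∈ M := by
  rw [← mul_one f]
  refine mul_mem_of_mem_adjoin _ _ ?_ hf 1 one_mem_basisModule
  rintro _ (rfl | rfl | rfl | rfl) m hm
  exacts [mul_mem_of_mem _ d_mem hm, mul_mem_of_mem _ c_mem hm, u₀_mul_mem hm, u₁_mul_mem hm]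

theorem basisElt_mem_invSL (i : BasisIndex F) : basisElt F i ∈ invSL F := by
  intro A
  rcases i with ⟨i, j⟩ | ⟨i, j, k⟩ | ⟨s, k⟩ <;> simp only [basisElt, map_mul, map_pow, act_u₁,
    act_u₁Star, act_u₀]
  rw [act_h F A (by omega)]

/-! ### Invariants of `SL₂` after inverting `d` -/

theorem exists_d_pow_mul_mem (f : R F) :
    ∃ n, d F ^ n * f ∈ Algebra.adjoin F {x 0, x 1, u₀ F, u₁ F} := by
  set E := Algebra.adjoin F {x 0, x 1, u₀ F, u₁ F} with hE
  have hx0 : x 0 ∈ E := Algebra.subset_adjoin (by simp)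
  have hx1 : x 1 ∈ E := Algebra.subset_adjoin (by simp)
  have hu0 : u₀ F ∈ E := Algebra.subset_adjoin (by simp)
  have hu1 : u₁ F ∈ E := Algebra.subset_adjoin (by simp)
  have hd : d F ∈ E := by
    rw [d_eq]
    exact sub_mem (mul_mem hx1 (pow_mem hx0 _)) (mul_mem (pow_mem hx1 _) hx0)
  have hf : f ∈ Algebra.adjoin F {x 0, x 1, y 0, y 1} := by
    rw [adjoin_variables]; exact Algebra.mem_top
  induction hf using Algebra.adjoin_induction with
  | mem a ha =>
    rcases ha with rfl | rfl | rfl | rfl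
    · exact ⟨0, by simpa using hx0⟩
    · exact ⟨0, by simpa using hx1⟩
    -- `y 0` and `y 1` by Cramer's rule
    · refine ⟨1, ?_⟩
      rw [show d F ^ 1 * y 0 = x 1 * u₁ F - x 1 ^ q * u₀ F by rw [d_eq, u₀, u₁]; ring]
      exact sub_mem (mul_mem hx1 hu1) (mul_mem (pow_mem hx1 _) hu0)
    · refine ⟨1, ?_⟩
      rw [show d F ^ 1 * y 1 = x 0 ^ q * u₀ F - x 0 * u₁ F by rw [d_eq, u₀, u₁]; ring]
      exact sub_mem (mul_mem (pow_mem hx0 _) hu0) (mul_mem hx0 hu1)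
  | algebraMap r => exact ⟨0, by simpa using E.algebraMap_mem r⟩
  | add a b _ _ h1 h2 =>
    obtain ⟨m, hm⟩ := h1
    obtain ⟨n, hn⟩ := h2
    refine ⟨m + n, ?_⟩
    rw [show d F ^ (m + n) * (a + b) = d F ^ n * (d F ^ m * a) + d F ^ m * (d F ^ n * b) by ring]
    exact add_mem (mul_mem (pow_mem hd _) hm) (mul_mem (pow_mem hd _) hn)
  | mul a b _ _ h1 h2 =>
    obtain ⟨m, hm⟩ := h1
    obtain ⟨n, hn⟩ := h2
    refine ⟨m + n, ?_⟩
    rw [show d F ^ (m + n) * (a * b) = (d F ^ m * a) * (d F ^ n * b) by ring]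
    exact mul_mem hm hn

/-- After inverting `d`, the ring of invariants of `SL₂` is generated by `d, c, u₀, u₁`: the
variables `y i` may be replaced by the invariants `u₀, u₁`, and the rest is Dickson's theorem with
coefficients, in the form of the descent lemma. -/
theorem exists_d_pow_mul_mem_adjoin {f : R F} (hf : f ∈ invSL F) :
    ∃ n, d F ^ n * f ∈ Algebra.adjoin F {d F, c F, u₀ F, u₁ F} := by
  classical
  obtain ⟨n, hn⟩ := exists_d_pow_mul_mem f
  refine ⟨n, ?_⟩
  set C' := Algebra.adjoin F {d F, c F, u₀ F, u₁ F} with hC'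
  have hd : d F ∈ C' := Algebra.subset_adjoin (by simp)
  have hc : c F ∈ C' := Algebra.subset_adjoin (by simp)
  have hu0 : u₀ F ∈ C' := Algebra.subset_adjoin (by simp)
  have hu1 : u₁ F ∈ C' := Algebra.subset_adjoin (by simp)
  have hinv : C' ≤ invSL F := by
    refine Algebra.adjoin_le ?_
    rintro _ (rfl | rfl | rfl | rfl) A
    exacts [act_d A A, act_c A A, act_u₀ A, act_u₁ A]
  have hspan : ∀ g ∈ Algebra.adjoin F {x 0, x 1, u₀ F, u₁ F},
      g ∈ Submodule.span C' (Set.range (dicksonGen F)) := by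
    intro g hg
    rw [← mul_one g]
    refine mul_mem_of_mem_adjoin _ _ ?_ hg 1 one_mem_span_dicksonGen
    rintro _ (rfl | rfl | rfl | rfl) m hm
    exacts [x_mul_mem_span_dicksonGen hd hc 0 hm, x_mul_mem_span_dicksonGen hd hc 1 hm,
      mul_mem_of_mem _ hu0 hm, mul_mem_of_mem _ hu1 hm]
  obtain ⟨i, hi⟩ := exists_dicksonGen_eq_one F
  have hcard : Fintype.card (DicksonIndex F) = Fintype.card SL := by
    rw [card_dicksonIndex, ← natCard_specialLinearGroup, Nat.card_eq_fintype_card]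
  refine mem_of_mem_span_of_invariant hcard (fun A => act A A)
    (Algebra.adjoin F {x 0, x 1, u₀ F, u₁ F}).toSubmonoid ?_ (dicksonGen F) C'
    (fun a ha A => hinv ha A) hspan i hi _ ?_ (hspan _ hn)
  · intro A B hAB
    refine eq_of_act_x_eq (B := A) (B' := B) (Fin.forall_fin_two.2 ⟨?_, ?_⟩)
    · exact hAB _ (Algebra.subset_adjoin (by simp))
    · exact hAB _ (Algebra.subset_adjoin (by simp))
  · intro A
    rw [map_mul, map_pow, act_d, hf]

theorem exists_d_pow_mul_mem_basisModule {f : R F} (hf : f ∈ invSL F) : ∃ n, d F ^ n * f ∈ M :=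
  let ⟨n, hn⟩ := exists_d_pow_mul_mem_adjoin hf
  ⟨n, adjoin_le_basisModule hn⟩

theorem exists_dStar_pow_mul_mem_basisModule {f : R F} (hf : f ∈ invSL F) :
    ∃ n, dStar F ^ n * f ∈ M := by
  obtain ⟨n, hn⟩ := exists_d_pow_mul_mem_basisModule (invol_mem_invSL hf)
  exact ⟨n, by simpa using invol_mem_basisModule hn⟩

/-! ### The basis -/

variable (F) in
theorem card_basisIndex : Fintype.card (BasisIndex F) = q * (q ^ 2 - 1) := by
  simp only [Fintype.card_prod, Fintype.card_sum, Fintype.card_fin]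
  obtain ⟨n, hn⟩ : ∃ n, q = n + 2 := ⟨q - 2, by have := two_le_card F; omega⟩
  rw [hn, show n + 2 - 1 = n + 1 by omega, show n + 2 - 2 = n by omega]
  have : (n + 2) ^ 2 - 1 = n ^ 2 + 4 * n + 3 := by
    rw [Nat.sub_eq_iff_eq_add (Nat.one_le_pow _ _ (by omega))]
    ring
  rw [this]
  ring

/-- The basis elements are as many as the elements of `SL₂`, and the elements `(A, 1)` of
`SL₂ × SL₂`, which fix the Dickson algebra, have distinct values on `u₀`. -/
theorem sum_mul_basisElt_eq_zero {a : BasisIndex F → R F} (ha : ∀ i, a i ∈ invSLSL F)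
    (hsum : ∑ i, a i * basisElt F i = 0) (i : BasisIndex F) : a i = 0 := by
  classical
  have hcard : Fintype.card (BasisIndex F) = Fintype.card SL := by
    rw [card_basisIndex, ← natCard_specialLinearGroup, Nat.card_eq_fintype_card]
  refine eq_zero_of_sum_mul_eq_zero hcard (fun A => act A 1) (Submonoid.powers (u₀ F)) ?_
    (basisElt F) (dicksonAlgebra F) (fun a ha A => dicksonAlgebra_le_invSLSL ha A 1) ?_ a
    (fun i A => ha i A 1) hsum i
  · intro A B hAB
    have hu := hAB _ (Submonoid.mem_powers _)
    -- `u₀` determines the images of the `x i` as coefficients of the `y i`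
    refine eq_of_act_x_eq (B := 1) (B' := 1) fun i => ?_
    let φ : R F →ₐ[F] R F := aeval (Sum.elim x (Pi.single i 1))
    have hφ (A : SL) (j : Fin 2) : φ (act A 1 (x j)) = act A 1 (x j) := by
      revert j
      have hx (j : Fin 2) : φ (x j) = x j := by simp [φ, x]
      refine Fin.forall_fin_two.2 ⟨?_, ?_⟩ <;>
        simp only [act_x_zero, act_x_one, map_sub, map_mul, hx, algHom_C, algebraMap_eq]
    have hu' := congrArg φ hu
    simp only [u₀, map_add, map_mul, hφ, act_y] at hu'
    revert hu'
    fin_cases i <;> simp [φ, y]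
  · rintro _ ⟨k, rfl⟩
    have := u₀_pow_mul_mem (F := F) one_mem_basisModule k
    rwa [mul_one] at this

/-- An invariant lies in the free module `M` spanned by the basis elements since it does so after
multiplication by a power of `d`, and also by a power of `dStar`; these are coprime. -/
theorem mem_basisModule {f : R F} (hf : f ∈ invSL F) : f ∈ M := by
  classical
  obtain ⟨m, hm⟩ := exists_d_pow_mul_mem_basisModule hf
  obtain ⟨n, hn⟩ := exists_dStar_pow_mul_mem_basisModule hf
  obtain ⟨a, ha⟩ := (Submodule.mem_span_range_iff_exists_fun _).1 hm
  obtain ⟨b, hb⟩ := (Submodule.mem_span_range_iff_exists_fun _).1 hn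
  simp only [Subalgebra.smul_def, smul_eq_mul] at ha hb
  have hab : ∀ i, dStar F ^ n * (a i : R F) = d F ^ m * (b i : R F) := by
    intro i
    rw [← sub_eq_zero]
    refine sum_mul_basisElt_eq_zero
      (a := fun i => dStar F ^ n * (a i : R F) - d F ^ m * (b i : R F)) (fun i => ?_) ?_ i
    · rw [invSLSL_eq]
      exact sub_mem (mul_mem (pow_mem dStar_mem _) (a i).2) (mul_mem (pow_mem d_mem _) (b i).2)
    · simp only [sub_mul, Finset.sum_sub_distrib, mul_assoc, ← Finset.mul_sum, ha, hb]
      ring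
  -- `d` and `dStar` are distinct variables of the polynomial ring `dicksonAlgebra F`
  have hdvd : ∀ i, ∃ r ∈ dicksonAlgebra F, (a i : R F) = d F ^ m * r := by
    intro i
    have hind := algebraicIndependent_dickson F
    have hrange : dicksonAlgebra F = (aeval (R := F) ![d F, c F, dStar F, cStar F]).range := by
      rw [← Algebra.adjoin_range_eq_range_aeval, dicksonAlgebra_eq_adjoin_range]
    have key : ∀ r : dicksonAlgebra F,
        ∃ p, aeval (R := F) ![d F, c F, dStar F, cStar F] p = (r : R F) := by
      rintro ⟨r, hr⟩
      rw [hrange] at hr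
      exact hr
    obtain ⟨p, hp⟩ := key (a i)
    obtain ⟨p', hp'⟩ := key (b i)
    have hpp : (X 2 : MvPolynomial (Fin 4) F) ^ n * p = X 0 ^ m * p' := by
      apply hind
      rw [map_mul, map_mul, hp, hp']
      simpa using hab i
    have h02 : ¬ (X 0 : MvPolynomial (Fin 4) F) ∣ X 2 ^ n := fun hdiv => by
      have := (X_prime (R := F) (i := (0 : Fin 4))).dvd_of_dvd_pow hdiv
      rw [X_dvd_X] at this
      simp at this
    obtain ⟨r, hr⟩ := (X_prime (R := F) (i := (0 : Fin 4))).pow_dvd_of_dvd_mul_left m h02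
      (Dvd.intro _ hpp.symm)
    refine ⟨aeval ![d F, c F, dStar F, cStar F] r, ?_, ?_⟩
    · rw [hrange]
      exact ⟨r, rfl⟩
    · rw [← hp, hr]
      simp
  choose r hr hra using hdvd
  have hfr : f = ∑ i, r i * basisElt F i := by
    apply mul_left_cancel₀ (pow_ne_zero m (d_ne_zero F))
    rw [← ha, Finset.mul_sum]
    exact Finset.sum_congr rfl fun i _ => by rw [hra, mul_assoc]
  rw [hfr]
  exact Submodule.sum_mem _ fun i _ => mul_mem_of_mem _ (hr i) (Submodule.subset_span ⟨i, rfl⟩)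

variable (F) in
theorem exists_basis : ∃ b : Module.Basis (BasisIndex F) (invSLSL F) (invSL F),
    ∀ i, (b i : R F) = basisElt F i := by
  classical
  have hli : LinearIndependent (invSLSL F)
      (fun i => (⟨basisElt F i, basisElt_mem_invSL i⟩ : invSL F)) := by
    rw [Fintype.linearIndependent_iff]
    intro a ha i
    apply Subtype.ext
    refine sum_mul_basisElt_eq_zero (a := fun i => (a i : R F)) (fun i => (a i).2) ?_ i
    simpa [coe_smul_inv] using congrArg (Subtype.val : invSL F → R F) ha
  refine ⟨Module.Basis.mk hli ?_, fun i => by rw [Module.Basis.mk_apply]⟩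
  rintro ⟨f, hf⟩ -
  obtain ⟨a, ha⟩ := (Submodule.mem_span_range_iff_exists_fun _).1 (mem_basisModule hf)
  rw [Submodule.mem_span_range_iff_exists_fun]
  refine ⟨fun i => ⟨a i, dicksonAlgebra_le_invSLSL (a i).2⟩, Subtype.ext ?_⟩
  simpa [coe_smul_inv, Subalgebra.smul_def] using ha

end BasisModule

/-! ### Generating functions -/

section GeneratingFunction

variable {J : Type*}

/-- The generating function `∑ₙ #{j | deg j = n} tⁿ` of a degree function with finite fibres. -/
noncomputable def genFun (deg : J → ℕ) : PowerSeries ℤ :=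
  PowerSeries.mk fun n => (Nat.card {j // deg j = n} : ℤ)

theorem finite_degree_le_prod {w : ℕ} (hw : 0 < w) {deg : J → ℕ}
    (hdeg : ∀ n, {j | deg j ≤ n}.Finite) (n : ℕ) :
    {p : ℕ × J | w * p.1 + deg p.2 ≤ n}.Finite := by
  refine ((Set.finite_Iic n).prod (hdeg n)).subset ?_
  rintro ⟨k, j⟩ hkj
  have : k ≤ w * k := Nat.le_mul_of_pos_left k hw
  simp only [Set.mem_ofPred_eq] at hkj
  exact ⟨show k ≤ n by omega, show deg j ≤ n by omega⟩

/-- An additional polynomial variable of degree `w` divides the generating function by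
`1 - t ^ w`. -/
theorem genFun_prod {w : ℕ} (hw : 0 < w) {deg : J → ℕ} (hdeg : ∀ n, {j | deg j ≤ n}.Finite) :
    genFun (fun p : ℕ × J => w * p.1 + deg p.2) * (1 - PowerSeries.X ^ w) = genFun deg := by
  have hfin (n : ℕ) : Finite {p : ℕ × J // w * p.1 + deg p.2 = n} :=
    ((finite_degree_le_prod hw hdeg n).subset fun _ hp => le_of_eq hp).to_subtype
  have hfin' (n : ℕ) : Finite {j // deg j = n} :=
    ((hdeg n).subset fun _ hp => le_of_eq hp).to_subtype
  ext n
  rw [mul_sub, mul_one, map_sub, PowerSeries.coeff_mul_X_pow']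
  simp only [genFun, PowerSeries.coeff_mk]
  -- the pairs `(0, j)` and the pairs `(k + 1, j)`
  let e₀ : {j // deg j = n} → {p : ℕ × J // w * p.1 + deg p.2 = n} :=
    fun j => ⟨(0, j.1), by simpa using j.2⟩
  by_cases hn : w ≤ n
  · rw [if_pos hn]
    let e : {j // deg j = n} ⊕ {p : ℕ × J // w * p.1 + deg p.2 = n - w} ≃
        {p : ℕ × J // w * p.1 + deg p.2 = n} := Equiv.ofBijective
      (Sum.elim e₀ fun p => ⟨(p.1.1 + 1, p.1.2), by have := p.2; simp only [mul_add]; omega⟩) (by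
        constructor
        · rintro (⟨j, hj⟩ | ⟨⟨k, j⟩, hj⟩) (⟨j', hj'⟩ | ⟨⟨k', j'⟩, hj'⟩) hjj <;>
            simp_all [e₀]
        · rintro ⟨⟨_ | k, j⟩, hj⟩
          · exact ⟨.inl ⟨j, by simpa using hj⟩, rfl⟩
          · refine ⟨.inr ⟨(k, j), ?_⟩, rfl⟩
            simp only [mul_add] at hj ⊢
            omega)
    rw [← Nat.card_congr e, Nat.card_sum]
    push_cast
    ring
  · rw [if_neg hn, sub_zero, Nat.cast_inj]
    refine (Nat.card_congr (Equiv.ofBijective e₀ ⟨?_, ?_⟩)).symm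
    · rintro ⟨j, hj⟩ ⟨j', hj'⟩ hjj
      simpa [e₀] using hjj
    · rintro ⟨⟨_ | k, j⟩, hj⟩
      · exact ⟨⟨j, by simpa using hj⟩, rfl⟩
      · simp only [mul_add] at hj
        omega

theorem genFun_of_fintype [Fintype J] (deg : J → ℕ) :
    genFun deg = ∑ j, PowerSeries.X ^ deg j := by
  classical
  ext n
  simp [genFun, PowerSeries.coeff_X_pow, Fintype.card_subtype, eq_comm]

/-- The square of a geometric sum, collected by powers. -/
theorem geom_sum_sq {S : Type*} [CommRing S] (T : S) (n : ℕ) :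
    ∑ i ∈ Finset.range (n + 1), ∑ j ∈ Finset.range (n + 1), T ^ i * T ^ j =
      ∑ m ∈ Finset.range (n + 1), ((m + 1 : ℕ) : S) * T ^ m +
      ∑ m ∈ Finset.range n, ((n - m : ℕ) : S) * T ^ (n + 1 + m) := by
  set B : ℕ → S := fun n => ∑ m ∈ Finset.range n, ((n - m : ℕ) : S) * T ^ m with hB
  set G : ℕ → S := fun n => ∑ m ∈ Finset.range n, T ^ m with hG
  have hGs (n : ℕ) : G (n + 1) = G n + T ^ n := Finset.sum_range_succ _ _
  have hTG (n : ℕ) : T * G n = G n - 1 + T ^ n := by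
    have := mul_geom_sum T n
    linear_combination this
  have hBs (n : ℕ) : B (n + 1) = B n + G (n + 1) := by
    have h1 : B n = ∑ m ∈ Finset.range (n + 1), ((n - m : ℕ) : S) * T ^ m := by
      rw [Finset.sum_range_succ, Nat.sub_self, Nat.cast_zero, zero_mul, add_zero]
    rw [h1, ← Finset.sum_add_distrib]
    refine Finset.sum_congr rfl fun m hm => ?_
    rw [Nat.succ_sub (Nat.lt_succ_iff.1 (Finset.mem_range.1 hm))]
    push_cast
    ring
  have hTB (n : ℕ) : T * B n = B n + G (n + 1) - (n + 1) := by
    induction n with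
    | zero => simp [hB, hG]
    | succ n ih =>
      rw [hBs, mul_add, ih, hTG, hGs (n + 1)]
      push_cast
      ring
  have hB' (n : ℕ) : ∑ m ∈ Finset.range n, ((n - m : ℕ) : S) * T ^ (n + 1 + m) =
      T ^ (n + 1) * B n := by
    rw [hB, Finset.mul_sum]
    exact Finset.sum_congr rfl fun m _ => by ring
  simp only [← Finset.mul_sum, ← Finset.sum_mul, hB']
  change G (n + 1) * G (n + 1) = _
  induction n with
  | zero => simp [hB, hG]
  | succ n ih =>
    rw [Finset.sum_range_succ, hBs, hGs (n + 1)]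
    have h1 := hTG (n + 1)
    have h2 := hTB n
    push_cast at ih ⊢
    linear_combination ih - T ^ (n + 1) * h1 - T ^ (n + 1) * h2

end GeneratingFunction

/-! ### The Hilbert series of a graded algebra with a homogeneous basis -/

section Homogeneous

variable {F : Type*} [Field F]

theorem hilbertSeries_eq_genFun {J : Type*} (A : Subalgebra F (R F)) (v : J → R F)
    (hli : LinearIndependent F v)
    (hspan : Submodule.span F (Set.range v) = Subalgebra.toSubmodule A) (deg : J → ℕ)
    (hdeg : ∀ j, (v j).IsHomogeneous (deg j)) : hilbertSeries A = genFun deg := by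
  ext n
  simp only [hilbertSeries, genFun, PowerSeries.coeff_mk, Nat.cast_inj]
  have key : Subalgebra.toSubmodule A ⊓ homogeneousSubmodule (Fin 2 ⊕ Fin 2) F n =
      Submodule.span F (Set.range fun j : {j // deg j = n} => v j) := by
    apply le_antisymm
    · rintro f ⟨hfA, hfn⟩
      have hmap : Submodule.map (homogeneousComponent n) (Submodule.span F (Set.range v)) ≤
          Submodule.span F (Set.range fun j : {j // deg j = n} => v j) := by
        rw [Submodule.map_span_le]
        rintro _ ⟨j, rfl⟩
        rw [homogeneousComponent_of_mem (hdeg j)]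
        split_ifs with hj
        · exact Submodule.subset_span ⟨⟨j, hj.symm⟩, rfl⟩
        · exact Submodule.zero_mem _
      rw [← homogeneousComponent_eq_self hfn]
      exact hmap ⟨f, by rwa [hspan], rfl⟩
    · rw [Submodule.span_le]
      rintro _ ⟨⟨j, rfl⟩, rfl⟩
      exact ⟨hspan ▸ Submodule.subset_span ⟨j, rfl⟩, hdeg j⟩
  rw [key]
  exact Module.finrank_eq_nat_card_basis
    (Module.Basis.span (hli.comp (Subtype.val : {j // deg j = n} → J) Subtype.val_injective))

theorem isHomogeneous_of_mul_left {f g : R F} {m n : ℕ} (hf : f.IsHomogeneous m) (hf0 : f ≠ 0)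
    (hfg : (f * g).IsHomogeneous (m + n)) : g.IsHomogeneous n := by
  let _ : GradedAlgebra (homogeneousSubmodule (Fin 2 ⊕ Fin 2) F) := gradedAlgebra
  have h1 := DirectSum.coe_decompose_mul_add_of_left_mem
    (homogeneousSubmodule (Fin 2 ⊕ Fin 2) F) (b := g) (j := n)
    ((mem_homogeneousSubmodule m f).2 hf)
  rw [DirectSum.decompose_of_mem_same _ ((mem_homogeneousSubmodule _ _).2 hfg)] at h1
  rw [mul_left_cancel₀ hf0 h1]
  exact (DirectSum.decompose (homogeneousSubmodule (Fin 2 ⊕ Fin 2) F) g n).2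

theorem isHomogeneous_x (i : Fin 2) : (x i : R F).IsHomogeneous 1 := isHomogeneous_X _ _

theorem isHomogeneous_y (i : Fin 2) : (y i : R F).IsHomogeneous 1 := isHomogeneous_X _ _

theorem isHomogeneous_invol {f : R F} {n : ℕ} (hf : f.IsHomogeneous n) :
    (invol f).IsHomogeneous n := by
  have := hf.aeval (n := 1) (Sum.elim (fun i => y i.rev) (fun i => x i.rev) : _ → R F)
    (by rintro (i | i); exacts [isHomogeneous_y _, isHomogeneous_x _])
  rwa [one_mul] at this

variable (F) in
theorem isHomogeneous_u₀ : (u₀ F).IsHomogeneous 2 :=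
  ((isHomogeneous_x 0).mul (isHomogeneous_y 0)).add ((isHomogeneous_x 1).mul (isHomogeneous_y 1))

end Homogeneous

section HilbertSeries

variable (F : Type*) [Field F] [Fintype F]

local notation "q" => Fintype.card F

/-! ### The Hilbert series of the invariants -/

theorem isHomogeneous_u₁ : (u₁ F).IsHomogeneous (q + 1) := by
  have hx (i : Fin 2) := (isHomogeneous_x (F := F) i).pow q
  simp only [one_mul] at hx
  exact ((hx 0).mul (isHomogeneous_y 0)).add ((hx 1).mul (isHomogeneous_y 1))

theorem isHomogeneous_u₁Star : (u₁Star F).IsHomogeneous (q + 1) :=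
  isHomogeneous_invol (isHomogeneous_u₁ F)

theorem isHomogeneous_d : (d F).IsHomogeneous (q + 1) := by
  have hx (i : Fin 2) := (isHomogeneous_x (F := F) i).pow q
  simp only [one_mul] at hx
  rw [d_eq, mul_comm]
  exact ((hx 0).mul (isHomogeneous_x 1)).sub ((hx 1).mul (isHomogeneous_x 0))

theorem isHomogeneous_dStar : (dStar F).IsHomogeneous (q + 1) :=
  isHomogeneous_invol (isHomogeneous_d F)

theorem isHomogeneous_c : (c F).IsHomogeneous (q ^ 2 - q) := by
  have hq := two_le_card F
  have hN : (orbitProd F).IsHomogeneous q := by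
    have h1 := (isHomogeneous_x (F := F) 0).pow q
    have h2 := (isHomogeneous_x (F := F) 0).mul ((isHomogeneous_x (F := F) 1).pow (q - 1))
    rw [one_mul] at h1
    rw [one_mul, show 1 + (q - 1) = q by omega] at h2
    exact h1.sub h2
  have h1 := (isHomogeneous_x (F := F) 1).pow (q * (q - 1))
  rw [one_mul] at h1
  rw [c_eq, show q ^ 2 - q = q * (q - 1) by rw [Nat.mul_sub_one, sq]]
  exact (hN.pow (q - 1)).add h1

theorem isHomogeneous_cStar : (cStar F).IsHomogeneous (q ^ 2 - q) :=
  isHomogeneous_invol (isHomogeneous_c F)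

theorem isHomogeneous_h {s : ℕ} (hs : s < q) : (h F s).IsHomogeneous (q ^ 2 - q) := by
  have hq := two_le_card F
  obtain ⟨n, hn⟩ : ∃ n, q = s + n + 1 := ⟨q - s - 1, by omega⟩
  refine isHomogeneous_of_mul_left ((isHomogeneous_u₀ F).pow q) (pow_ne_zero _ (u₀_ne_zero F)) ?_
  have hle : q ≤ q ^ 2 := Nat.le_self_pow two_ne_zero _
  have h1 := ((isHomogeneous_u₁ F).pow (s + 1)).mul ((isHomogeneous_dStar F).pow (q - s - 1))
  have h2 := ((isHomogeneous_u₁Star F).pow (q - s)).mul ((isHomogeneous_d F).pow s)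
  rw [← mul_add, show s + 1 + (q - s - 1) = q by omega] at h1
  rw [← mul_add, show q - s + s = q by omega] at h2
  rw [u₀_pow_mul_h F hs, show 2 * q + (q ^ 2 - q) = (q + 1) * q by rw [add_one_mul, ← sq]; omega]
  exact h1.add h2

/-- The total degrees of the basis elements. -/
def basisDeg : BasisIndex F → ℕ
  | .inl (i, j) => (q + 1) * i + (q + 1) * j
  | .inr (.inl (i, j, k)) => (q + 1) * i + (q + 1) * j + 2 * (k + 1)
  | .inr (.inr (_, k)) => q ^ 2 - q + 2 * k

theorem isHomogeneous_basisElt (i : BasisIndex F) :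
    (basisElt F i).IsHomogeneous (basisDeg F i) := by
  rcases i with ⟨i, j⟩ | ⟨i, j, k⟩ | ⟨s, k⟩ <;> simp only [basisElt, basisDeg]
  · exact ((isHomogeneous_u₁Star F).pow i).mul ((isHomogeneous_u₁ F).pow j)
  · exact (((isHomogeneous_u₁Star F).pow i).mul ((isHomogeneous_u₁ F).pow j)).mul
      ((isHomogeneous_u₀ F).pow _)
  · exact (isHomogeneous_h F (by omega)).mul ((isHomogeneous_u₀ F).pow _)

/-- The products of the monomials in the Dickson invariants with the basis elements; they form a
basis of the invariants of `SL₂` over the ground field. -/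
noncomputable def monomialBasisElt (p : ℕ × ℕ × ℕ × ℕ × BasisIndex F) : R F :=
  d F ^ p.1 * c F ^ p.2.1 * dStar F ^ p.2.2.1 * cStar F ^ p.2.2.2.1 * basisElt F p.2.2.2.2

/-- The total degree of `monomialBasisElt F p`. -/
def monomialBasisDeg (p : ℕ × ℕ × ℕ × ℕ × BasisIndex F) : ℕ :=
  (q + 1) * p.1 + ((q ^ 2 - q) * p.2.1 + ((q + 1) * p.2.2.1 +
    ((q ^ 2 - q) * p.2.2.2.1 + basisDeg F p.2.2.2.2)))

theorem isHomogeneous_monomialBasisElt (p : ℕ × ℕ × ℕ × ℕ × BasisIndex F) :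
    (monomialBasisElt F p).IsHomogeneous (monomialBasisDeg F p) := by
  simp only [monomialBasisDeg, ← add_assoc]
  exact (((((isHomogeneous_d F).pow _).mul ((isHomogeneous_c F).pow _)).mul
    ((isHomogeneous_dStar F).pow _)).mul ((isHomogeneous_cStar F).pow _)).mul
    (isHomogeneous_basisElt F _)

/-- Exponent vectors in four variables as quadruples. -/
noncomputable def exponentEquiv : (Fin 4 →₀ ℕ) ≃ ℕ × ℕ × ℕ × ℕ :=
  Finsupp.equivFunOnFinite.trans
    { toFun f := (f 0, f 1, f 2, f 3)
      invFun p := ![p.1, p.2.1, p.2.2.1, p.2.2.2]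
      left_inv f := by ext i; fin_cases i <;> rfl
      right_inv p := rfl }

theorem exists_monomial_basis :
    ∃ b : Module.Basis (ℕ × ℕ × ℕ × ℕ × BasisIndex F) F (invSL F),
      ∀ p, (b p : R F) = monomialBasisElt F p := by
  obtain ⟨b, hb⟩ := exists_basis F
  have hrange : Algebra.adjoin F (Set.range ![d F, c F, dStar F, cStar F]) = invSLSL F := by
    rw [invSLSL_eq, dicksonAlgebra_eq_adjoin_range]
  have hind := algebraicIndependent_dickson F
  let ε : MvPolynomial (Fin 4) F ≃ₐ[F] invSLSL F :=
    hind.aevalEquiv.trans (Subalgebra.equivOfEq _ _ hrange)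
  have hε (p) : (ε p : R F) = aeval ![d F, c F, dStar F, cStar F] p :=
    hind.algebraMap_aevalEquiv p
  let β : Module.Basis (Fin 4 →₀ ℕ) F (invSLSL F) := (basisMonomials (Fin 4) F).map ε.toLinearEquiv
  have hβ (m : Fin 4 →₀ ℕ) :
      (β m : R F) = d F ^ m 0 * c F ^ m 1 * dStar F ^ m 2 * cStar F ^ m 3 := by
    simp only [β, Module.Basis.map_apply, coe_basisMonomials, AlgEquiv.toLinearEquiv_apply, hε,
      aeval_monomial, map_one, one_mul, Finsupp.prod_fintype _ _ (fun _ => pow_zero _),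
      Fin.prod_univ_four]
    rfl
  have : IsScalarTower F (invSLSL F) (invSL F) := ⟨fun r a f => Subtype.ext (by
    rw [coe_smul_inv, Subalgebra.coe_smul, Subalgebra.coe_smul, coe_smul_inv, smul_mul_assoc])⟩
  let e : (Fin 4 →₀ ℕ) × BasisIndex F ≃ ℕ × ℕ × ℕ × ℕ × BasisIndex F :=
    (exponentEquiv.prodCongr (Equiv.refl _)).trans
      { toFun p := (p.1.1, p.1.2.1, p.1.2.2.1, p.1.2.2.2, p.2)
        invFun p := ((p.1, p.2.1, p.2.2.1, p.2.2.2.1), p.2.2.2.2)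
        left_inv _ := rfl
        right_inv _ := rfl }
  refine ⟨(β.smulTower b).reindex e, fun p => ?_⟩
  obtain ⟨⟨m, i⟩, rfl⟩ := e.surjective p
  rw [Module.Basis.reindex_apply, Equiv.symm_apply_apply, Module.Basis.smulTower_apply,
    coe_smul_inv, hβ, hb]
  rfl

theorem hilbertSeries_invSL : hilbertSeries (invSL F) = genFun (monomialBasisDeg F) := by
  obtain ⟨b, hb⟩ := exists_monomial_basis F
  have hb' : monomialBasisElt F = (Subalgebra.toSubmodule (invSL F)).subtype ∘ b :=
    funext fun p => (hb p).symm
  refine hilbertSeries_eq_genFun _ (monomialBasisElt F) ?_ ?_ _ (isHomogeneous_monomialBasisElt F)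
  · rw [hb']
    exact b.linearIndependent.map' _ (Submodule.ker_subtype _)
  · rw [hb', Set.range_comp, Submodule.span_image]
    erw [b.span_eq]
    exact Submodule.map_subtype_top _

theorem hilbertSeries_mul :
    hilbertSeries (invSL F) * ((1 - PowerSeries.X ^ (q + 1)) ^ 2 *
      (1 - PowerSeries.X ^ (q ^ 2 - q)) ^ 2) = ∑ i, PowerSeries.X ^ basisDeg F i := by
  have hw : 0 < q + 1 := Nat.succ_pos _
  have hw' : 0 < q ^ 2 - q := Nat.sub_pos_of_lt (by
    rw [sq]; exact lt_mul_of_one_lt_left (by have := two_le_card F; omega) (two_le_card F))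
  have f0 (n : ℕ) : {i | basisDeg F i ≤ n}.Finite := Set.toFinite _
  have f1 := finite_degree_le_prod hw' f0
  have f2 := finite_degree_le_prod hw f1
  have f3 := finite_degree_le_prod hw' f2
  have e1 := genFun_prod hw f3
  rw [← genFun_of_fintype, ← genFun_prod hw' f0, ← genFun_prod hw f1, ← genFun_prod hw' f2,
    ← genFun_prod hw f3, hilbertSeries_invSL]
  unfold monomialBasisDeg
  ring

theorem H₁_eq {n : ℕ} (hn : 1 ≤ n) : H₁ n = ∑ i ∈ Finset.range n, ∑ j ∈ Finset.range n,
    (PowerSeries.X ^ (n + 1)) ^ i * (PowerSeries.X ^ (n + 1)) ^ j := by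
  obtain ⟨n, rfl⟩ := Nat.exists_eq_add_of_le' hn
  rw [geom_sum_sq, H₁, Nat.add_sub_cancel]
  simp only [← pow_mul, mul_comm (n + 1 + 1)]

theorem H₂_eq {n : ℕ} (hn : 2 ≤ n) (k : ℕ) :
    H₂ n k = ∑ i ∈ Finset.range (n - 1), ∑ j ∈ Finset.range (n - 1),
      (PowerSeries.X ^ (n + 1)) ^ i * (PowerSeries.X ^ (n + 1)) ^ j * PowerSeries.X ^ (2 * k) := by
  obtain ⟨n, rfl⟩ := Nat.exists_eq_add_of_le' hn
  simp only [← Finset.sum_mul]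
  rw [show n + 2 - 1 = n + 1 by omega, geom_sum_sq, H₂, show n + 2 - 1 = n + 1 by omega,
    show n + 2 - 2 = n by omega, add_mul, Finset.sum_mul, Finset.sum_mul]
  simp only [← pow_mul, mul_assoc, ← pow_add]
  congr 1 <;> refine Finset.sum_congr rfl fun m _ => ?_ <;> congr 2 <;> ring

theorem sum_X_pow_basisDeg : ∑ i, (PowerSeries.X : PowerSeries ℤ) ^ basisDeg F i =
    H₁ q + ∑ k ∈ Finset.Icc 1 q, H₂ q k + H₃ q := by
  have hq := two_le_card F
  have hpow (a : ℕ) : (PowerSeries.X : PowerSeries ℤ) ^ ((q + 1) * a) =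
      (PowerSeries.X ^ (q + 1)) ^ a := pow_mul _ _ _
  rw [Fintype.sum_sum_type, Fintype.sum_sum_type, ← add_assoc]
  simp only [basisDeg, Fintype.sum_prod_type, pow_add _ ((q + 1) * _), pow_add _ ((q + 1) * _ + _),
    hpow]
  congr 1
  congr 1
  · rw [H₁_eq (by omega)]
    simp only [Finset.sum_range]
  · rw [show Finset.Icc 1 q = Finset.Ico 1 (q + 1) from rfl, Finset.sum_Ico_eq_sum_range,
      Nat.add_sub_cancel]
    simp only [H₂_eq hq, Finset.sum_range, add_comm 1]
    rw [eq_comm, Finset.sum_comm]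
    exact Finset.sum_congr rfl fun i _ => Finset.sum_comm
  · rw [Finset.sum_comm, H₃, Finset.sum_range]
    simp

end HilbertSeries

end VectorCovector

theorem theorem3p3 (F : Type*) [Field F] [Fintype F] :
    -- the quotients that define `c_{2,1}` and the `h_s` exist in the polynomial ring
    VectorCovector.d F * VectorCovector.c F = VectorCovector.cNum F ∧
    (∀ s < Fintype.card F,
      VectorCovector.u₀ F ^ Fintype.card F * VectorCovector.h F s = VectorCovector.hNum F s) ∧
    -- `R^{SL₂ × SL₂}` is the polynomial ring in `d_{2,2}, c_{2,1}, d_{2,2}^*, c_{2,1}^*`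
    AlgebraicIndependent F
      ![VectorCovector.d F, VectorCovector.c F, VectorCovector.dStar F, VectorCovector.cStar F] ∧
    VectorCovector.invSLSL F = Algebra.adjoin F
      {VectorCovector.d F, VectorCovector.c F, VectorCovector.dStar F, VectorCovector.cStar F} ∧
    -- `R^{SL₂}` is free over it on the listed elements
    (∃ b : Module.Basis (VectorCovector.BasisIndex F)
        (VectorCovector.invSLSL F) (VectorCovector.invSL F),
      ∀ i, (b i : VectorCovector.R F) = VectorCovector.basisElt F i) ∧
    Fintype.card (VectorCovector.BasisIndex F) =
      Fintype.card F * (Fintype.card F ^ 2 - 1) ∧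
    -- the Hilbert series
    VectorCovector.hilbertSeries (VectorCovector.invSL F) *
        ((1 - PowerSeries.X ^ (Fintype.card F + 1)) ^ 2 *
          (1 - PowerSeries.X ^ (Fintype.card F ^ 2 - Fintype.card F)) ^ 2) =
      VectorCovector.H₁ (Fintype.card F) +
        ∑ k ∈ Finset.Icc 1 (Fintype.card F), VectorCovector.H₂ (Fintype.card F) k +
        VectorCovector.H₃ (Fintype.card F) := by
  classical
  refine ⟨VectorCovector.d_mul_c F, fun s hs => VectorCovector.u₀_pow_mul_h F hs,
    VectorCovector.algebraicIndependent_dickson F, VectorCovector.invSLSL_eq F,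
    VectorCovector.exists_basis F, ?_, ?_⟩
  · convert VectorCovector.card_basisIndex F
  · rw [VectorCovector.hilbertSeries_mul, VectorCovector.sum_X_pow_basisDeg]
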